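/- Let $p>2$. A metric graph $G$ is given by vertices and edges, each edge $e$ having a length $\ell_e\in(0,\infty]$ and being identified with $[0,\ell_e]$ (with $[0,\infty)$ if $\ell_e=\infty$); an edge of finite length has two endpoints, an edge of infinite length (a half-line) has one. $G$ is locally finite if only finitely many edges meet at each vertex. It is bounded if it has finitely many edges, all of finite length, and unbounded otherwise. An infinite chain of $G$ equivalent to a half-line is a sequence $e_1,e_2,\dots$ of pairwise distinct edges of finite length with $\sum_i\ell_{e_i}=\infty$, each $e_{i+1}$ starting at the vertex where $e_i$ stops, such that, for every $i\ge1$, the only ends of edges of $G$ lying at the vertex between $e_i$ and $e_{i+1}$ are the terminal end of $e_i$ and the initial end of $e_{i+1}$. We say that $G$ is unbounded only along half-lines or chains equivalent to half-lines if all its edges except finitely many (each of which is bounded or is itself a half-line) belong to finitely many such infinite chains. An outer vertex is a vertex at which exactly one end of an edge lies. Let $H^1_0(G)$ be the space of continuous functions $v$ on $G$ (real-valued or complex-valued) that vanish at all outer vertices, belong to $H^1(e)$ for each edge $e$, and satisfy $\|v\|_{H^1_0(G)}^2=\int_G(|v'|^2+|v|^2)\,dx=\sum_e\int_e(|v'|^2+|v|^2)\,dx<\infty$.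 Let $C_p(G)$ be the best (smallest) constant in $$\Big(\int_G|v|^p\,dx\Big)^{2/p}\le C\int_G(|v'|^2+|v|^2)\,dx\qquad\text{for all }v\in H^1_0(G),$$ let $C_p(\mathbb R)$ be the best constant in the same inequality on $\mathbb R$, for $v\in H^1(\mathbb R)$, and consider the minimisation problem $$\inf_{0\ne v\in H^1_0(G)}F(v),\qquad F(v)=\frac{\int_G(|v'|^2+|v|^2)\,dx}{\big(\int_G|v|^p\,dx\big)^{2/p}}.\tag{min}$$ A minimising sequence for (min) is a sequence $(v_n)$ in $H^1_0(G)$, normalised by $\int_G|v_n|^p\,dx=1$ for all $n$, such that $F(v_n)$ converges to the infimum in (min). Theorem. Let $p>2$ and let $G$ be a locally finite unbounded metric graph that is unbounded only along half-lines or chains equivalent to half-lines. Then all minimising sequences for (min) are relatively compact in $H^1_0(G)$ if and only if $C_p(G)>C_p(\mathbb R)$. Moreover, if $C_p(G)>C_p(\mathbb R)$, then (min) has a minimiser, that is, there is $0\neq v\in H^1_0(G)$ at which $F$ attains its infimum. -/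

import Mathlib

open scoped ENNReal Topology
open MeasureTheory Filter

noncomputable section

/-! ### Sobolev functions of one variable

The set `I` is an interval of `ℝ`. The functions are scalar-valued (`𝕜 = ℝ` or `𝕜 = ℂ`). -/

/-- `f` belongs to the Sobolev space `H¹(I)` (that is, `f` is its continuous representative on the
interval `I`) and `g` is its weak derivative: `f, g ∈ L²(I)`, and `f` is a primitive of `g`. -/
structure IsH1On {𝕜 : Type*} [RCLike 𝕜] (I : Set ℝ) (f g : ℝ → 𝕜) : Prop where
  memLp_fn : MemLp f 2 (volume.restrict I)
  memLp_der : MemLp g 2 (volume.restrict I)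
  primitive : ∀ x ∈ I, ∀ y ∈ I, f y - f x = ∫ t in x..y, g t

/-- `∫_I (|g|² + |f|²) dx`, where `g` stands for the derivative of `f`. -/
def energyOn {𝕜 : Type*} [RCLike 𝕜] (I : Set ℝ) (f g : ℝ → 𝕜) : ℝ≥0∞ :=
  ∫⁻ x in I, (‖g x‖ₑ ^ 2 + ‖f x‖ₑ ^ 2)

/-- `∫_I |f|^p dx`. -/
def powOn {𝕜 : Type*} [RCLike 𝕜] (p : ℝ) (I : Set ℝ) (f : ℝ → 𝕜) : ℝ≥0∞ :=
  ∫⁻ x in I, ‖f x‖ₑ ^ p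

/-- `C_p(ℝ)`: the best constant `C` in `(∫_ℝ |f|^p)^{2/p} ≤ C ∫_ℝ (|f'|² + |f|²)`
for `f ∈ H¹(ℝ)`. -/
def bestConstLine (𝕜 : Type*) [RCLike 𝕜] (p : ℝ) : ℝ≥0∞ :=
  sInf {C : ℝ≥0∞ | ∀ f g : ℝ → 𝕜, IsH1On Set.univ f g →
    powOn p Set.univ f ^ (2 / p) ≤ C * energyOn Set.univ f g}

/-- A metric graph with vertex set `V` and edge set `E`. Every edge `e` has a length
`len e ∈ (0, ∞]` and is identified with the interval `[0, len e]` (with `[0, ∞)` if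
`len e = ∞`); `src e` is its endpoint at coordinate `0`, and, if the length is finite,
`tgt e` is its endpoint at coordinate `len e`. An unbounded edge has only one endpoint.
Loops and multiple edges are allowed. -/
structure MetricGraph (V E : Type*) where
  len : E → ℝ≥0∞
  len_pos : ∀ e, 0 < len e
  src : E → V
  tgt : {e : E // len e ≠ ⊤} → V

namespace MetricGraph

variable {V E : Type*} (G : MetricGraph V E)

/-- The interval with which the edge `e` is identified. -/
def interval (e : E) : Set ℝ := {x : ℝ | 0 ≤ x ∧ ENNReal.ofReal x ≤ G.len e}

/-- The (finite) ends of the edges: the end at coordinate `0` of every edge, and the end at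
coordinate `len e` of every bounded edge. -/
abbrev EdgeEnd : Type _ := E ⊕ {e : E // G.len e ≠ ⊤}

/-- The vertex at which an end of an edge lies. -/
def vert : G.EdgeEnd → V := Sum.elim G.src G.tgt

/-- The edge to which an end belongs. -/
def edge : G.EdgeEnd → E := Sum.elim id Subtype.val

/-- The coordinate of an end on its edge. -/
def pos : G.EdgeEnd → ℝ := Sum.elim (fun _ => 0) (fun e => (G.len e.1).toReal)

/-- A vertex at which exactly one end of an edge lies: an outer vertex of the graph. -/
def IsOuter (v : V) : Prop := ∃! a : G.EdgeEnd, G.vert a = v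

/-- Only finitely many edges meet at each vertex. -/
def LocallyFinite : Prop := ∀ v : V, {a : G.EdgeEnd | G.vert a = v}.Finite

/-- A locally finite graph (without accumulation of edges) is bounded exactly if it is compact,
that is, if it has finitely many edges, all of finite length; otherwise it is unbounded. -/
def IsUnbounded : Prop := ¬ (Finite E ∧ ∀ e, G.len e ≠ ⊤)

/-- The end at which a bounded edge starts when it is traversed in the direction given by the
Boolean: `true` is the direction of increasing coordinate. -/
def startEnd (c : {e : E // G.len e ≠ ⊤} × Bool) : G.EdgeEnd :=
  if c.2 then Sum.inl c.1.1 else Sum.inr c.1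

/-- The end at which a bounded edge stops when it is traversed in the direction given by the
Boolean. -/
def finishEnd (c : {e : E // G.len e ≠ ⊤} × Bool) : G.EdgeEnd :=
  if c.2 then Sum.inr c.1 else Sum.inl c.1.1

/-- An infinite chain of bounded edges of `G` along which `G` looks like a half-line: each edge
starts at the vertex where the previous one stops, the edges are pairwise distinct, no other edge
of `G` is attached to the vertices between consecutive edges, and the total length is infinite. -/
structure IsHalfLineChain (c : ℕ → {e : E // G.len e ≠ ⊤} × Bool) : Prop where
  injective : Function.Injective fun n => (c n).1
  consecutive : ∀ n, G.vert (G.finishEnd (c n)) = G.vert (G.startEnd (c (n + 1)))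
  no_branching : ∀ n, ∀ a : G.EdgeEnd, G.vert a = G.vert (G.finishEnd (c n)) →
    a = G.finishEnd (c n) ∨ a = G.startEnd (c (n + 1))
  infinite_length : ∑' n, G.len (c n).1.1 = ⊤

/-- `G` is unbounded only along half-lines or chains equivalent to half-lines: up to finitely many
edges (each of which is bounded, or is a half-line if its length is infinite), `G` consists of
finitely many infinite chains equivalent to half-lines. A finite chain of edges whose last edge is
unbounded falls under the finitely many exceptional edges. -/
def UnboundedOnlyAlongHalfLines : Prop :=
  ∃ S : Set (ℕ → {e : E // G.len e ≠ ⊤} × Bool), S.Finite ∧ (∀ c ∈ S, G.IsHalfLineChain c) ∧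
    {e : E | ∀ c ∈ S, ∀ n, (c n).1.1 ≠ e}.Finite

variable (𝕜 : Type*) [RCLike 𝕜]

/-- `∫_G (|v'|² + |v|²) dx`, where `f` stands for `v` and `g` for `v'`. -/
def energy {𝕜 : Type*} [RCLike 𝕜] (f g : E → ℝ → 𝕜) : ℝ≥0∞ :=
  ∑' e, energyOn (G.interval e) (f e) (g e)

/-- An element of `H¹₀(G)`: a function `fn` on `G` with its weak derivative `der`, edge by edge;
`fn` is in `H¹` of each edge, it is continuous at the vertices, it vanishes at the outer vertices,
and the sum of the squared `H¹` norms over the edges is finite.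
Values outside of the intervals of the edges play no role. -/
structure H10 where
  fn : E → ℝ → 𝕜
  der : E → ℝ → 𝕜
  isH1On : ∀ e, IsH1On (G.interval e) (fn e) (der e)
  continuous_at_vertices : ∀ a b : G.EdgeEnd, G.vert a = G.vert b →
    fn (G.edge a) (G.pos a) = fn (G.edge b) (G.pos b)
  dirichlet : ∀ a : G.EdgeEnd, G.IsOuter (G.vert a) → fn (G.edge a) (G.pos a) = 0
  energy_lt_top : G.energy fn der < ⊤

variable {G 𝕜}

namespace H10

/-- `‖v‖²` in `H¹₀(G)`, that is `∫_G (|v'|² + |v|²) dx`. -/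
def normSq (v : G.H10 𝕜) : ℝ≥0∞ := G.energy v.fn v.der

/-- `‖v - w‖²` in `H¹₀(G)`. -/
def distSq (v w : G.H10 𝕜) : ℝ≥0∞ := G.energy (v.fn - w.fn) (v.der - w.der)

/-- `∫_G |v|^p dx`. -/
def powInt (p : ℝ) (v : G.H10 𝕜) : ℝ≥0∞ := ∑' e, powOn p (G.interval e) (v.fn e)

/-- The quotient `F_{G,p}(v) = ∫_G (|v'|² + |v|²) dx / (∫_G |v|^p dx)^{2/p}` (for `v ≠ 0`). -/
def quotient (p : ℝ) (v : G.H10 𝕜) : ℝ≥0∞ := v.normSq / v.powInt p ^ (2 / p)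

end H10

variable (G 𝕜)

/-- The infimum of the quotient over the nonzero functions of `H¹₀(G)`. -/
def infQuotient (p : ℝ) : ℝ≥0∞ := ⨅ (v : G.H10 𝕜) (_ : v.powInt p ≠ 0), v.quotient p

/-- `C_p(G)`: the best constant `C` in `(∫_G |v|^p)^{2/p} ≤ C ∫_G (|v'|² + |v|²)`
for `v ∈ H¹₀(G)`. -/
def bestConst (p : ℝ) : ℝ≥0∞ :=
  sInf {C : ℝ≥0∞ | ∀ v : G.H10 𝕜, v.powInt p ^ (2 / p) ≤ C * v.normSq}

variable {G 𝕜}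

/-- A minimiser of the quotient over the nonzero functions of `H¹₀(G)`. -/
def IsMinimizer (p : ℝ) (v : G.H10 𝕜) : Prop :=
  v.powInt p ≠ 0 ∧ v.quotient p = G.infQuotient 𝕜 p

/-- A minimising sequence of the quotient, normalised (as the quotient is invariant under
multiplication by constants) by `∫_G |v_n|^p = 1`. -/
def IsMinimizingSeq (p : ℝ) (u : ℕ → G.H10 𝕜) : Prop :=
  (∀ n, (u n).powInt p = 1) ∧
    Tendsto (fun n => (u n).quotient p) atTop (𝓝 (G.infQuotient 𝕜 p))

/-- Relative compactness of a set of functions in `H¹₀(G)`: every sequence in the set has a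
subsequence that converges in the norm of `H¹₀(G)` to some element of `H¹₀(G)`. -/
def IsRelativelyCompact (S : Set (G.H10 𝕜)) : Prop :=
  ∀ s : ℕ → G.H10 𝕜, (∀ n, s n ∈ S) →
    ∃ φ : ℕ → ℕ, StrictMono φ ∧ ∃ v : G.H10 𝕜,
      Tendsto (fun n => (s (φ n)).distSq v) atTop (𝓝 0)

end MetricGraph

end

/-! Write C = C_p(G) and D = C_p(ℝ); the infimum in (min) is 1/C (`infQuotient_eq`). A minimising
sequence can lose compactness only by escaping along a half-line, where it sees ℝ instead of G.

Let C > D and ∫|u|^p = 1. On a long initial stretch of a ray there is a point t where |u(t)| is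
small. Cutting u at t with affine ramps of length 1 gives v in H¹₀(G) and w in H¹(ℝ) with ‖v‖² +
‖w‖² ≤ ‖u‖² + 4|u(t)|². Since 2/p ≤ 1, the map s ↦ s^(2/p) is subadditive, so 1 ≤ C‖v‖² + D‖w‖² ≤
C(‖u‖² + 4|u(t)|²) - (C - D)‖w‖². Along a minimising sequence C‖u‖² tends to 1, hence ‖w‖² is small
and u is uniformly small far out (`Part.IsRay.exists_line_part`, `Part.IsRay.tight`).

Functions of bounded energy are bounded and equicontinuous. With the smallness far out, an
Arzelà–Ascoli argument makes a subsequence uniformly Cauchy on each of the finitely many bounded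
edges and rays that cover G (`Part.uniformCauchy`), and |v|^p ≤ (sup |v|)^(p-2) |v|² makes it Cauchy
in L^p (`cauchy_powInt`). No weak limits are needed to reach the norm of H¹₀: the midpoint of two
late terms has L^p norm close to 1, hence energy not much below 1/C, and the parallelogram law
leaves little energy for their difference (`cauchy_distSq`). Completeness (`H10.exists_limit`) gives
the limit, which is a minimiser (`IsMinimizingSeq.isMinimizer_of_tendsto`).

If C ≤ D, nearly optimal functions on ℝ are cut off on the left and translated far out on a ray.
They form a minimising sequence that leaves every bounded piece of the ray, so a limit could only be
0, whereas the energies tend to 1/C > 0.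

A chain is parametrised isometrically by [0, ∞) and handled exactly like an infinite edge
(`Part.ofChain`, `Part.isRay_ofChain`). -/

section OneVariable

variable {𝕜 : Type*} [RCLike 𝕜] {I J : Set ℝ} {f g f₁ g₁ f₂ g₂ : ℝ → 𝕜} {p : ℝ}

/-! ### Sobolev functions on an interval: embedding, change of variables, gluing. -/

theorem memLp_two_iff_lintegral {μ : Measure ℝ} {f : ℝ → 𝕜} :
    MemLp f 2 μ ↔ AEStronglyMeasurable f μ ∧ ∫⁻ x, ‖f x‖ₑ ^ 2 ∂μ < ⊤ := by
  have h := eLpNorm_lt_top_iff_lintegral_rpow_enorm_lt_top (f := f) (μ := μ) (p := 2)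
    two_ne_zero ENNReal.ofNat_ne_top
  simp only [ENNReal.toReal_ofNat, ENNReal.rpow_ofNat] at h
  rw [MemLp, h]

theorem eLpNorm_two_sq {μ : Measure ℝ} (f : ℝ → 𝕜) :
    eLpNorm f 2 μ ^ 2 = ∫⁻ x, ‖f x‖ₑ ^ 2 ∂μ := by
  have h := eLpNorm_nnreal_pow_eq_lintegral (f := f) (μ := μ) (p := 2) two_ne_zero
  simpa using h

theorem enorm_add_sq_le (a b : 𝕜) : ‖a + b‖ₑ ^ 2 ≤ 2 * ‖a‖ₑ ^ 2 + 2 * ‖b‖ₑ ^ 2 := by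
  have h : ‖a + b‖ ^ 2 ≤ 2 * ‖a‖ ^ 2 + 2 * ‖b‖ ^ 2 := by
    nlinarith [norm_add_le a b, norm_nonneg (a + b), norm_nonneg a, norm_nonneg b,
      sq_nonneg (‖a‖ - ‖b‖)]
  have h' := ENNReal.ofReal_le_ofReal h
  rw [ENNReal.ofReal_add (by positivity) (by positivity), ENNReal.ofReal_mul zero_le_two,
    ENNReal.ofReal_mul zero_le_two, ENNReal.ofReal_pow (norm_nonneg _),
    ENNReal.ofReal_pow (norm_nonneg _), ENNReal.ofReal_pow (norm_nonneg _)] at h'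
  simpa [ofReal_norm] using h'

namespace IsH1On

theorem aemeasurable_fn (h : IsH1On I f g) :
    AEMeasurable (fun x => ‖f x‖ₑ ^ 2) (volume.restrict I) :=
  h.memLp_fn.1.enorm.pow_const 2

theorem aemeasurable_der (h : IsH1On I f g) :
    AEMeasurable (fun x => ‖g x‖ₑ ^ 2) (volume.restrict I) :=
  h.memLp_der.1.enorm.pow_const 2

theorem energyOn_eq (h : IsH1On I f g) :
    energyOn I f g = (∫⁻ x in I, ‖g x‖ₑ ^ 2) + ∫⁻ x in I, ‖f x‖ₑ ^ 2 :=
  lintegral_add_left' h.aemeasurable_der _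

theorem energyOn_lt_top (h : IsH1On I f g) : energyOn I f g < ⊤ := by
  rw [h.energyOn_eq]
  exact ENNReal.add_lt_top.2 ⟨(memLp_two_iff_lintegral.1 h.memLp_der).2,
    (memLp_two_iff_lintegral.1 h.memLp_fn).2⟩

theorem mono (h : IsH1On I f g) (hJ : J ⊆ I) : IsH1On J f g where
  memLp_fn := h.memLp_fn.mono_measure (Measure.restrict_mono hJ le_rfl)
  memLp_der := h.memLp_der.mono_measure (Measure.restrict_mono hJ le_rfl)
  primitive x hx y hy := h.primitive x (hJ hx) y (hJ hy)

end IsH1On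

theorem energyOn_mono (hJ : J ⊆ I) (f g : ℝ → 𝕜) : energyOn J f g ≤ energyOn I f g :=
  lintegral_mono_set hJ

theorem powOn_mono (hJ : J ⊆ I) (p : ℝ) (f : ℝ → 𝕜) : powOn p J f ≤ powOn p I f :=
  lintegral_mono_set hJ

theorem lintegral_fn_le_energyOn (I : Set ℝ) (f g : ℝ → 𝕜) :
    ∫⁻ x in I, ‖f x‖ₑ ^ 2 ≤ energyOn I f g :=
  lintegral_mono fun _ => le_add_self

theorem lintegral_der_le_energyOn (I : Set ℝ) (f g : ℝ → 𝕜) :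
    ∫⁻ x in I, ‖g x‖ₑ ^ 2 ≤ energyOn I f g :=
  lintegral_mono fun _ => le_self_add

theorem energyOn_congr (hI : MeasurableSet I) (hf : ∀ x ∈ I, f₁ x = f₂ x)
    (hg : ∀ᵐ x, x ∈ I → g₁ x = g₂ x) : energyOn I f₁ g₁ = energyOn I f₂ g₂ := by
  refine setLIntegral_congr_fun_ae hI ?_
  filter_upwards [hg] with x hx hxI
  rw [hx hxI, hf x hxI]

theorem powOn_congr (hI : MeasurableSet I) (hf : ∀ x ∈ I, f₁ x = f₂ x) :
    powOn p I f₁ = powOn p I f₂ :=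
  setLIntegral_congr_fun hI fun x hx => by simp only [hf x hx]

theorem intervalIntegrable_of_memLp [I.OrdConnected] (hg : MemLp g 2 (volume.restrict I)) {x y : ℝ}
    (hx : x ∈ I) (hy : y ∈ I) : IntervalIntegrable g volume x y := by
  rw [intervalIntegrable_iff]
  have hsub : Set.uIoc x y ⊆ I :=
    Set.uIoc_subset_uIcc.trans (Set.OrdConnected.uIcc_subset ‹_› hx hy)
  have : IsFiniteMeasure (volume.restrict (Set.uIoc x y)) :=
    ⟨by rw [Measure.restrict_apply_univ, Set.uIoc]; exact measure_Ioc_lt_top⟩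
  exact (hg.mono_measure (Measure.restrict_mono hsub le_rfl)).integrable one_le_two

/-- Cauchy–Schwarz for the increment of a primitive. -/
theorem enorm_integral_sq_le [I.OrdConnected] (hg : MemLp g 2 (volume.restrict I)) {x y : ℝ}
    (hx : x ∈ I) (hy : y ∈ I) :
    ‖∫ t in x..y, g t‖ₑ ^ 2 ≤ ENNReal.ofReal |y - x| * ∫⁻ t in I, ‖g t‖ₑ ^ 2 := by
  have hsub : Set.uIoc x y ⊆ I :=
    Set.uIoc_subset_uIcc.trans (Set.OrdConnected.uIcc_subset ‹_› hx hy)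
  have h1 : ‖∫ t in x..y, g t‖ₑ ≤ eLpNorm g 1 (volume.restrict (Set.uIoc x y)) := by
    rw [eLpNorm_one_eq_lintegral_enorm]
    refine le_trans (le_of_eq ?_) (enorm_integral_le_lintegral_enorm _)
    rw [← ofReal_norm, ← ofReal_norm, intervalIntegral.norm_intervalIntegral_eq]
  have hg' := hg.mono_measure (Measure.restrict_mono hsub (le_refl volume))
  have h2 := eLpNorm_le_eLpNorm_mul_rpow_measure_univ (one_le_two) hg'.1
  have hvol : volume.restrict (Set.uIoc x y) Set.univ = ENNReal.ofReal |y - x| := by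
    rw [Measure.restrict_apply_univ, Set.uIoc, Real.volume_Ioc, max_sub_min_eq_abs]
  rw [hvol] at h2
  calc ‖∫ t in x..y, g t‖ₑ ^ 2
      ≤ (eLpNorm g 2 (volume.restrict (Set.uIoc x y)) *
          ENNReal.ofReal |y - x| ^ (1 / (1 : ℝ≥0∞).toReal - 1 / (2 : ℝ≥0∞).toReal)) ^ 2 := by
        gcongr; exact h1.trans h2
    _ = ENNReal.ofReal |y - x| * ∫⁻ t in Set.uIoc x y, ‖g t‖ₑ ^ 2 := by
        rw [mul_pow, eLpNorm_two_sq, mul_comm, ← ENNReal.rpow_natCast, ← ENNReal.rpow_mul]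
        norm_num
    _ ≤ _ := by gcongr

/-- Hölder continuity of exponent 1/2, with a modulus that depends on the energy alone. This is the
equicontinuity behind the Arzelà–Ascoli argument. -/
theorem IsH1On.enorm_sub_sq_le [I.OrdConnected] (h : IsH1On I f g) {x y : ℝ} (hx : x ∈ I)
    (hy : y ∈ I) : ‖f y - f x‖ₑ ^ 2 ≤ ENNReal.ofReal |y - x| * energyOn I f g := by
  rw [h.primitive x hx y hy]
  exact (enorm_integral_sq_le h.memLp_der hx hy).trans
    (mul_le_mul_right (lintegral_der_le_energyOn I f g) _)

/-- The constant of the embedding of `H¹` into the bounded functions, for an interval that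
contains an interval of length `ℓ` around each of its points. -/
noncomputable def supConst (ℓ : ℝ) : ℝ≥0∞ := 2 * ENNReal.ofReal ℓ + 2 / ENNReal.ofReal ℓ

theorem supConst_ne_top {ℓ : ℝ} (hℓ : 0 < ℓ) : supConst ℓ ≠ ⊤ := by
  unfold supConst
  refine ENNReal.add_ne_top.2 ⟨ENNReal.mul_ne_top (by simp) (by simp), ?_⟩
  exact ENNReal.div_ne_top (by simp) (by simpa using hℓ)

/-- By Hölder continuity |f x|² ≤ 2|f y|² + 2ℓ·energy for all y in the interval; averaging over y
gives the constant 2/ℓ + 2ℓ. -/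
theorem IsH1On.enorm_sq_le [I.OrdConnected] (h : IsH1On I f g) {a ℓ x : ℝ} (hℓ : 0 < ℓ)
    (hI : Set.Icc a (a + ℓ) ⊆ I) (hx : x ∈ Set.Icc a (a + ℓ)) :
    ‖f x‖ₑ ^ 2 ≤ supConst ℓ * energyOn I f g := by
  set L := ENNReal.ofReal ℓ
  have hL0 : L ≠ 0 := by simpa [L] using hℓ
  have hLt : L ≠ ⊤ := by simp [L]
  have hvol : volume (Set.Icc a (a + ℓ)) = L := by simp [L]
  have hpt : ∀ y ∈ Set.Icc a (a + ℓ),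
      ‖f x‖ₑ ^ 2 ≤ 2 * ‖f y‖ₑ ^ 2 + 2 * (L * energyOn I f g) := by
    intro y hy
    have h1 := h.enorm_sub_sq_le (hI hy) (hI hx)
    have h2 : ENNReal.ofReal |x - y| ≤ L := by
      refine ENNReal.ofReal_le_ofReal (abs_le.2 ⟨?_, ?_⟩) <;> linarith [hx.1, hx.2, hy.1, hy.2]
    calc ‖f x‖ₑ ^ 2 = ‖f y + (f x - f y)‖ₑ ^ 2 := by rw [add_sub_cancel]
      _ ≤ _ := enorm_add_sq_le _ _
      _ ≤ _ := by gcongr; exact h1.trans (by gcongr)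
  have hint : L * ‖f x‖ₑ ^ 2 ≤ 2 * energyOn I f g + 2 * (L * energyOn I f g) * L := by
    calc L * ‖f x‖ₑ ^ 2 = ∫⁻ _ in Set.Icc a (a + ℓ), ‖f x‖ₑ ^ 2 := by
          rw [setLIntegral_const, hvol, mul_comm]
      _ ≤ ∫⁻ y in Set.Icc a (a + ℓ), (2 * ‖f y‖ₑ ^ 2 + 2 * (L * energyOn I f g)) :=
          setLIntegral_mono' measurableSet_Icc hpt
      _ = 2 * (∫⁻ y in Set.Icc a (a + ℓ), ‖f y‖ₑ ^ 2) + 2 * (L * energyOn I f g) * L := by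
          rw [lintegral_add_right _ measurable_const, setLIntegral_const, hvol,
            lintegral_const_mul' _ _ (by simp)]
      _ ≤ _ := by
          gcongr
          exact (lintegral_mono_set hI).trans (lintegral_fn_le_energyOn I f g)
  have e2 : ‖f x‖ₑ ^ 2 = L⁻¹ * (L * ‖f x‖ₑ ^ 2) := by
    rw [← mul_assoc, ENNReal.inv_mul_cancel hL0 hLt, one_mul]
  have e1 : 2 * (L * energyOn I f g) * L = L * (2 * L * energyOn I f g) := by ring
  rw [e2]
  refine (mul_le_mul_right hint L⁻¹).trans (le_of_eq ?_)
  rw [mul_add, e1, ← mul_assoc L⁻¹ L, ENNReal.inv_mul_cancel hL0 hLt, supConst, add_mul,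
    ENNReal.div_eq_inv_mul]
  ring

/-- A function of `H¹` takes a small value somewhere in a long interval. -/
theorem IsH1On.exists_enorm_sq_le (h : IsH1On I f g) {a ℓ : ℝ} (hℓ : 0 < ℓ)
    (hI : Set.Icc a (a + ℓ) ⊆ I) :
    ∃ t ∈ Set.Icc a (a + ℓ), ‖f t‖ₑ ^ 2 ≤ energyOn I f g / ENNReal.ofReal ℓ := by
  have hvol : volume (Set.Icc a (a + ℓ)) = ENNReal.ofReal ℓ := by simp
  obtain ⟨t, ht, hle⟩ := exists_le_setLAverage (μ := volume) (s := Set.Icc a (a + ℓ))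
    (f := fun x => ‖f x‖ₑ ^ 2) (by rw [hvol]; simpa using hℓ) (by rw [hvol]; simp)
    (h.mono hI).aemeasurable_fn
  refine ⟨t, ht, hle.trans ?_⟩
  rw [setLAverage_eq, hvol]
  gcongr
  exact (lintegral_mono_set hI).trans (lintegral_fn_le_energyOn I f g)

/-- A primitive from one base point is a primitive. -/
theorem IsH1On.of_base [I.OrdConnected] (hf : MemLp f 2 (volume.restrict I))
    (hg : MemLp g 2 (volume.restrict I)) {x₀ : ℝ} (hx₀ : x₀ ∈ I)
    (hp : ∀ y ∈ I, f y - f x₀ = ∫ t in x₀..y, g t) : IsH1On I f g where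
  memLp_fn := hf
  memLp_der := hg
  primitive x hx y hy := by
    have h1 := intervalIntegral.integral_interval_sub_left
      (intervalIntegrable_of_memLp hg hx₀ hy) (intervalIntegrable_of_memLp hg hx₀ hx)
    rw [← h1, ← hp x hx, ← hp y hy]
    ring

theorem IsH1On.congr [I.OrdConnected] (hI : MeasurableSet I) (h : IsH1On I f₁ g₁)
    (hf : ∀ x ∈ I, f₁ x = f₂ x) (hg : ∀ᵐ x, x ∈ I → g₁ x = g₂ x) : IsH1On I f₂ g₂ where
  memLp_fn := h.memLp_fn.ae_eq ((ae_restrict_iff' hI).2 (Eventually.of_forall hf))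
  memLp_der := h.memLp_der.ae_eq ((ae_restrict_iff' hI).2 hg)
  primitive x hx y hy := by
    rw [← hf x hx, ← hf y hy, h.primitive x hx y hy]
    refine intervalIntegral.integral_congr_ae ?_
    filter_upwards [hg] with t ht htI
    exact ht (Set.OrdConnected.uIcc_subset ‹_› hx hy (Set.uIoc_subset_uIcc htI))

theorem IsH1On.zero (I : Set ℝ) : IsH1On I (0 : ℝ → 𝕜) 0 where
  memLp_fn := MemLp.zero
  memLp_der := MemLp.zero
  primitive := by simp

theorem IsH1On.comb [I.OrdConnected] (h₁ : IsH1On I f₁ g₁) (h₂ : IsH1On I f₂ g₂) (a b : 𝕜) :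
    IsH1On I (fun x => a * f₁ x + b * f₂ x) (fun x => a * g₁ x + b * g₂ x) where
  memLp_fn := (h₁.memLp_fn.const_mul a).add (h₂.memLp_fn.const_mul b)
  memLp_der := (h₁.memLp_der.const_mul a).add (h₂.memLp_der.const_mul b)
  primitive x hx y hy := by
    rw [intervalIntegral.integral_add
      ((intervalIntegrable_of_memLp h₁.memLp_der hx hy).const_mul a)
      ((intervalIntegrable_of_memLp h₂.memLp_der hx hy).const_mul b),
      intervalIntegral.integral_const_mul, intervalIntegral.integral_const_mul,
      ← h₁.primitive x hx y hy, ← h₂.primitive x hx y hy]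
    ring

theorem IsH1On.affine (a b : ℝ) (c : 𝕜) (t : ℝ) :
    IsH1On (Set.Icc a b) (fun x => c * ((x - t : ℝ) : 𝕜)) (fun _ => c) where
  memLp_fn := by
    refine MemLp.of_bound (Continuous.aestronglyMeasurable (by fun_prop))
      (‖c‖ * (|a - t| + |b - t|)) ((ae_restrict_iff' measurableSet_Icc).2 (.of_forall ?_))
    intro x hx
    rw [norm_mul, RCLike.norm_ofReal]
    gcongr
    rcases le_total 0 (x - t) with h | h
    · rw [abs_of_nonneg h]; linarith [hx.2, le_abs_self (b - t), abs_nonneg (a - t)]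
    · rw [abs_of_nonpos h]; linarith [hx.1, neg_abs_le (a - t), abs_nonneg (b - t)]
  memLp_der := memLp_const c
  primitive x _ y _ := by
    rw [intervalIntegral.integral_const, RCLike.real_smul_eq_coe_mul]
    push_cast
    ring

/-- The change of variables `x ↦ a + σ x` with `σ = ±1`. -/
theorem measurePreserving_affine (a : ℝ) {σ : ℝ} (hσ : σ = 1 ∨ σ = -1) :
    MeasurePreserving (fun x : ℝ => a + σ * x) volume volume := by
  rcases hσ with rfl | rfl
  · simpa using measurePreserving_add_left volume a
  · simpa [sub_eq_add_neg] using Measure.measurePreserving_sub_left volume a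

theorem measurableEmbedding_affine (a : ℝ) {σ : ℝ} (hσ : σ = 1 ∨ σ = -1) :
    MeasurableEmbedding (fun x : ℝ => a + σ * x) := by
  rcases hσ with rfl | rfl
  · simpa using measurableEmbedding_addLeft a
  · simpa [sub_eq_add_neg] using (Homeomorph.subLeft a).measurableEmbedding

theorem setLIntegral_comp_affine (a : ℝ) {σ : ℝ} (hσ : σ = 1 ∨ σ = -1) (h : ℝ → ℝ≥0∞)
    (I : Set ℝ) :
    ∫⁻ x in (fun x : ℝ => a + σ * x) ⁻¹' I, h (a + σ * x) = ∫⁻ x in I, h x :=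
  (measurePreserving_affine a hσ).setLIntegral_comp_preimage_emb
    (measurableEmbedding_affine a hσ) h I

theorem IsH1On.comp_affine (h : IsH1On I f g) (a : ℝ) {σ : ℝ} (hσ : σ = 1 ∨ σ = -1) :
    IsH1On ((fun x : ℝ => a + σ * x) ⁻¹' I) (fun x => f (a + σ * x))
      (fun x => (σ : 𝕜) * g (a + σ * x)) := by
  have hmp : MeasurePreserving (fun x : ℝ => a + σ * x)
      (volume.restrict ((fun x : ℝ => a + σ * x) ⁻¹' I)) (volume.restrict I) :=
    (measurePreserving_affine a hσ).restrict_preimage_emb (measurableEmbedding_affine a hσ) I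
  have hσ0 : σ ≠ 0 := by rcases hσ with rfl | rfl <;> norm_num
  refine ⟨h.memLp_fn.comp_measurePreserving hmp,
    (h.memLp_der.comp_measurePreserving hmp).const_mul _, fun x hx y hy => ?_⟩
  rw [intervalIntegral.integral_const_mul, intervalIntegral.integral_comp_add_mul g hσ0,
    h.primitive _ hx _ hy, RCLike.real_smul_eq_coe_mul, ← mul_assoc, ← RCLike.ofReal_mul,
    mul_inv_cancel₀ hσ0]
  simp

/-- The point t is negligible, so both pieces may be taken closed, as gluing needs the value at t on
either side. -/
theorem setLIntegral_piecewise (A : Set ℝ) (t : ℝ) (h₁ h₂ : ℝ → ℝ≥0∞) :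
    ∫⁻ x in A, (if x ≤ t then h₁ x else h₂ x) =
      (∫⁻ x in A ∩ Set.Iic t, h₁ x) + ∫⁻ x in A ∩ Set.Ici t, h₂ x := by
  rw [← lintegral_inter_add_sdiff _ A measurableSet_Iic (B := Set.Iic t)]
  congr 1
  · refine lintegral_congr_ae ?_
    refine ae_restrict_of_ae_restrict_of_subset Set.inter_subset_right
      ((ae_restrict_iff' measurableSet_Iic).2 (.of_forall fun x hx => ?_))
    exact if_pos hx
  · have hs : A \ Set.Iic t = A ∩ Set.Ioi t := by ext x; simp
    have hae : (A ∩ Set.Ioi t : Set ℝ) =ᵐ[volume] (A ∩ Set.Ici t : Set ℝ) :=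
      (ae_eq_refl A).inter Ioi_ae_eq_Ici
    rw [hs, ← setLIntegral_congr hae]
    refine lintegral_congr_ae ?_
    refine ae_restrict_of_ae_restrict_of_subset Set.inter_subset_right
      ((ae_restrict_iff' measurableSet_Ioi).2 (.of_forall fun x hx => ?_))
    exact if_neg (not_le.2 hx)

theorem setLIntegral_split (A : Set ℝ) (t : ℝ) (h : ℝ → ℝ≥0∞) :
    ∫⁻ x in A, h x = (∫⁻ x in A ∩ Set.Iic t, h x) + ∫⁻ x in A ∩ Set.Ici t, h x := by
  simpa using setLIntegral_piecewise A t h h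

/-- The function that equals `f₁` up to `t` and `f₂` beyond `t`. -/
noncomputable def glue {β : Type*} (t : ℝ) (f₁ f₂ : ℝ → β) (x : ℝ) : β := if x ≤ t then f₁ x else f₂ x

theorem glue_of_le {β : Type*} {f₁ f₂ : ℝ → β} {t x : ℝ} (h : x ≤ t) : glue t f₁ f₂ x = f₁ x := if_pos h

theorem glue_of_gt {β : Type*} {f₁ f₂ : ℝ → β} {t x : ℝ} (h : t < x) : glue t f₁ f₂ x = f₂ x := if_neg (not_le.2 h)

theorem glue_of_ge {β : Type*} {f₁ f₂ : ℝ → β} {t x : ℝ} (ht : f₁ t = f₂ t) (h : t ≤ x) : glue t f₁ f₂ x = f₂ x := by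
  rcases h.eq_or_lt with rfl | h
  · rw [glue_of_le le_rfl, ht]
  · exact glue_of_gt h

theorem energyOn_glue (A : Set ℝ) (t : ℝ) (f₁ g₁ f₂ g₂ : ℝ → 𝕜) :
    energyOn A (glue t f₁ f₂) (glue t g₁ g₂) =
      energyOn (A ∩ Set.Iic t) f₁ g₁ + energyOn (A ∩ Set.Ici t) f₂ g₂ := by
  unfold energyOn
  rw [← setLIntegral_piecewise]
  refine lintegral_congr fun x => ?_
  by_cases h : x ≤ t <;> simp [glue, h]

/-- With the junction t as base point, the integral from t to y stays within one piece and never has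
to be split. -/
theorem IsH1On.glue {A : Set ℝ} [A.OrdConnected] {t : ℝ} (htA : t ∈ A)
    (h₁ : IsH1On (A ∩ Set.Iic t) f₁ g₁) (h₂ : IsH1On (A ∩ Set.Ici t) f₂ g₂)
    (ht : f₁ t = f₂ t) : IsH1On A (glue t f₁ f₂) (glue t g₁ g₂) := by
  have key : ∀ {k₁ k₂ : ℝ → 𝕜}, MemLp k₁ 2 (volume.restrict (A ∩ Set.Iic t)) →
      MemLp k₂ 2 (volume.restrict (A ∩ Set.Ici t)) →
      MemLp (_root_.glue t k₁ k₂) 2 (volume.restrict A) := by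
    intro k₁ k₂ hk₁ hk₂
    rw [memLp_two_iff_lintegral]
    constructor
    · have e : A = (A ∩ Set.Iic t) ∪ (A ∩ Set.Ioi t) := by
        rw [← Set.inter_union_distrib_left, Set.Iic_union_Ioi, Set.inter_univ]
      rw [e, aestronglyMeasurable_union_iff]
      have hk₂' := hk₂.mono_measure (Measure.restrict_mono (μ := volume) (Set.inter_subset_inter_right A
        (Set.Ioi_subset_Ici (le_refl t))) le_rfl)
      refine ⟨hk₁.1.congr ?_, hk₂'.1.congr ?_⟩
      · refine ae_restrict_of_ae_restrict_of_subset Set.inter_subset_right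
          ((ae_restrict_iff' measurableSet_Iic).2 (.of_forall fun x hx => ?_))
        exact (glue_of_le hx).symm
      · refine ae_restrict_of_ae_restrict_of_subset Set.inter_subset_right
          ((ae_restrict_iff' measurableSet_Ioi).2 (.of_forall fun x hx => ?_))
        exact (glue_of_gt hx).symm
    · have : ∀ x, ‖_root_.glue t k₁ k₂ x‖ₑ ^ 2 = if x ≤ t then ‖k₁ x‖ₑ ^ 2 else ‖k₂ x‖ₑ ^ 2 := by
        intro x; unfold _root_.glue; split_ifs <;> rfl
      simp only [this]
      rw [setLIntegral_piecewise]
      exact ENNReal.add_lt_top.2 ⟨(memLp_two_iff_lintegral.1 hk₁).2,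
        (memLp_two_iff_lintegral.1 hk₂).2⟩
  refine IsH1On.of_base (key h₁.memLp_fn h₂.memLp_fn) (key h₁.memLp_der h₂.memLp_der) htA ?_
  intro y hy
  rcases le_total y t with hyt | hyt
  · rw [glue_of_le hyt, glue_of_le le_rfl, h₁.primitive t ⟨htA, le_refl t⟩ y ⟨hy, hyt⟩]
    refine intervalIntegral.integral_congr fun x hx => ?_
    rw [Set.uIcc_of_ge hyt] at hx
    exact (glue_of_le hx.2).symm
  · rw [glue_of_ge ht hyt, glue_of_le le_rfl, ht, h₂.primitive t ⟨htA, le_refl t⟩ y ⟨hy, hyt⟩]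
    refine intervalIntegral.integral_congr_ae (.of_forall fun x hx => ?_)
    rw [Set.uIoc_of_le hyt] at hx
    exact (glue_of_gt hx.1).symm

end OneVariable

/-! ### Affine cut-offs, completeness of H¹ of an interval, and inequalities for powers. -/

section OneVariable

variable {𝕜 : Type*} [RCLike 𝕜] {I J : Set ℝ} {f g f₁ g₁ f₂ g₂ : ℝ → 𝕜} {p : ℝ}

/-- The cost of a ramp: over unit length, the slope and the height are both bounded by ‖c‖. -/
theorem energyOn_le_of_bound {c : 𝕜} (hf : ∀ x ∈ I, ‖f x‖ₑ ≤ ‖c‖ₑ)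
    (hg : ∀ x ∈ I, ‖g x‖ₑ ≤ ‖c‖ₑ) (hI : MeasurableSet I) (hvol : volume I ≤ 1) :
    energyOn I f g ≤ 2 * ‖c‖ₑ ^ 2 := by
  calc energyOn I f g ≤ ∫⁻ _ in I, 2 * ‖c‖ₑ ^ 2 := by
        refine setLIntegral_mono' hI fun x hx => ?_
        rw [two_mul]
        gcongr
        exacts [hg x hx, hf x hx]
    _ = 2 * ‖c‖ₑ ^ 2 * volume I := setLIntegral_const _ _
    _ ≤ _ := mul_le_of_le_one_right' hvol

theorem energyOn_zero (I : Set ℝ) : energyOn I (0 : ℝ → 𝕜) 0 = 0 := by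
  simp [energyOn]

theorem enorm_mul_ofReal_le (c : 𝕜) {s : ℝ} (h0 : 0 ≤ s) (h1 : s ≤ 1) :
    ‖c * (s : 𝕜)‖ₑ ≤ ‖c‖ₑ := by
  rw [enorm_mul]
  refine mul_le_of_le_one_right' ?_
  rw [← ofReal_norm, RCLike.norm_ofReal, abs_of_nonneg h0]
  simpa using h1

/-- A function on a half-line extends to the line by an affine ramp. -/
theorem IsH1On.exists_ramp_up {t : ℝ} (h : IsH1On (Set.Ici t) f g) :
    ∃ F G : ℝ → 𝕜, IsH1On Set.univ F G ∧ (∀ x, t ≤ x → F x = f x) ∧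
      (∀ x ≤ t - 1, F x = 0 ∧ G x = 0) ∧
      energyOn Set.univ F G ≤ energyOn (Set.Ici t) f g + 2 * ‖f t‖ₑ ^ 2 := by
  have hE : Set.Ici (t - 1) ∩ Set.Iic t = Set.Icc (t - 1) t := Set.Ici_inter_Iic
  have hE' : Set.Ici (t - 1) ∩ Set.Ici t = Set.Ici t := by
    rw [Set.Ici_inter_Ici]; congr 1; exact max_eq_right (by linarith)
  -- The ramp rises from 0 at t - 1 to f t at t. As its length is 1, its slope is f t, and it costs
  -- at most 2‖f t‖².
  set r : ℝ → 𝕜 := fun x => f t * ((x - (t - 1) : ℝ) : 𝕜)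
  have hr : IsH1On (Set.Icc (t - 1) t) r (fun _ => f t) := IsH1On.affine _ _ _ _
  have hrt : r t = f t := by simp [r]
  have h1 : IsH1On (Set.Ici (t - 1)) (_root_.glue t r f) (_root_.glue t (fun _ => f t) g) :=
    IsH1On.glue (by simp) (by rw [hE]; exact hr) (by rw [hE']; exact h) hrt
  have hz : (0 : ℝ → 𝕜) (t - 1) = _root_.glue t r f (t - 1) := by
    rw [glue_of_le (by linarith)]; simp [r]
  refine ⟨_root_.glue (t - 1) 0 (_root_.glue t r f),
    _root_.glue (t - 1) 0 (_root_.glue t (fun _ => f t) g),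
    IsH1On.glue (Set.mem_univ _) (IsH1On.zero _) (by rwa [Set.univ_inter]) hz, ?_, ?_, ?_⟩
  · intro x hx
    rw [glue_of_gt (by linarith), glue_of_ge hrt hx]
  · intro x hx
    simp [glue_of_le hx]
  · rw [energyOn_glue, energyOn_zero, zero_add, Set.univ_inter, energyOn_glue, hE, hE', add_comm]
    gcongr
    refine energyOn_le_of_bound (fun x hx => ?_) (fun _ _ => le_rfl) measurableSet_Icc
      (by simp [Real.volume_Icc])
    exact enorm_mul_ofReal_le _ (by linarith [hx.1]) (by linarith [hx.2])

/-- A function on a half-line is cut off by an affine ramp. -/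
theorem IsH1On.exists_ramp_down {s t : ℝ} (hst : s ≤ t) (h : IsH1On (Set.Icc s t) f g) :
    ∃ F G : ℝ → 𝕜, IsH1On (Set.Ici s) F G ∧ (∀ x, x ≤ t → F x = f x) ∧
      energyOn (Set.Ici s) F G ≤ energyOn (Set.Icc s t) f g + 2 * ‖f t‖ₑ ^ 2 := by
  have hE : Set.Ici t ∩ Set.Iic (t + 1) = Set.Icc t (t + 1) := Set.Ici_inter_Iic
  have hE' : Set.Ici s ∩ Set.Ici t = Set.Ici t := by
    rw [Set.Ici_inter_Ici]; congr 1; exact max_eq_right hst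
  have hE'' : Set.Ici s ∩ Set.Iic t = Set.Icc s t := Set.Ici_inter_Iic
  set r : ℝ → 𝕜 := fun x => -f t * ((x - (t + 1) : ℝ) : 𝕜)
  have hr : IsH1On (Set.Icc t (t + 1)) r (fun _ => -f t) := IsH1On.affine _ _ _ _
  have h1 : IsH1On (Set.Ici t) (_root_.glue (t + 1) r 0) (_root_.glue (t + 1) (fun _ => -f t) 0) :=
    IsH1On.glue (by simp) (hE ▸ hr) (IsH1On.zero _) (by simp [r])
  have hz : f t = _root_.glue (t + 1) r 0 t := by
    rw [glue_of_le (by linarith)]; simp [r]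
  refine ⟨_root_.glue t f (_root_.glue (t + 1) r 0),
    _root_.glue t g (_root_.glue (t + 1) (fun _ => -f t) 0),
    IsH1On.glue hst (by rw [hE'']; exact h) (by rw [hE']; exact h1) hz, ?_, ?_⟩
  · intro x hx
    rw [glue_of_le hx]
  · rw [energyOn_glue, hE', hE'', energyOn_glue, hE, energyOn_zero, add_zero]
    gcongr
    refine energyOn_le_of_bound (fun x hx => ?_) (fun _ _ => by simp) measurableSet_Icc
      (by simp [Real.volume_Icc])
    have : r x = f t * (((t + 1) - x : ℝ) : 𝕜) := by simp only [r]; push_cast; ring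
    rw [this]
    exact enorm_mul_ofReal_le _ (by linarith [hx.2]) (by linarith [hx.1])

theorem energyOn_Ici_split {s t : ℝ} (hst : s ≤ t) (f g : ℝ → 𝕜) :
    energyOn (Set.Ici s) f g = energyOn (Set.Icc s t) f g + energyOn (Set.Ici t) f g := by
  unfold energyOn
  rw [setLIntegral_split _ t, Set.Ici_inter_Iic, Set.Ici_inter_Ici,
    show s ⊔ t = t from max_eq_right hst]

theorem powOn_Ici_split {s t : ℝ} (hst : s ≤ t) (f : ℝ → 𝕜) :
    powOn p (Set.Ici s) f = powOn p (Set.Icc s t) f + powOn p (Set.Ici t) f := by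
  unfold powOn
  rw [setLIntegral_split _ t, Set.Ici_inter_Iic, Set.Ici_inter_Ici,
    show s ⊔ t = t from max_eq_right hst]

/-- The primitive identity involves two points, which lie in a common `A n`; only square
integrability has to be supplied globally. This allows a chain to be treated edge by edge. -/
theorem isH1On_of_iUnion {A : ℕ → Set ℝ} (hA : Monotone A) (hI : I = ⋃ n, A n)
    (h : ∀ n, IsH1On (A n) f g) (hf : ∫⁻ x in I, ‖f x‖ₑ ^ 2 < ⊤)
    (hg : ∫⁻ x in I, ‖g x‖ₑ ^ 2 < ⊤) : IsH1On I f g where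
  memLp_fn := memLp_two_iff_lintegral.2
    ⟨hI ▸ aestronglyMeasurable_iUnion_iff.2 fun n => (h n).memLp_fn.1, hf⟩
  memLp_der := memLp_two_iff_lintegral.2
    ⟨hI ▸ aestronglyMeasurable_iUnion_iff.2 fun n => (h n).memLp_der.1, hg⟩
  primitive x hx y hy := by
    rw [hI, Set.mem_iUnion] at hx hy
    obtain ⟨m, hm⟩ := hx
    obtain ⟨n, hn⟩ := hy
    exact (h (max m n)).primitive x (hA (le_max_left m n) hm) y (hA (le_max_right m n) hn)

theorem tendsto_of_enorm_sq_le {ι : Type*} {l : Filter ι} {a : ι → 𝕜} {b : 𝕜} {c : ι → ℝ≥0∞}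
    (h : ∀ i, ‖a i - b‖ₑ ^ 2 ≤ c i) (hc : Tendsto c l (𝓝 0)) : Tendsto a l (𝓝 b) := by
  rw [tendsto_iff_edist_tendsto_0]
  have h2 : Tendsto (fun i => edist (a i) b ^ 2) l (𝓝 0) :=
    tendsto_of_tendsto_of_tendsto_of_le_of_le tendsto_const_nhds hc (fun _ => zero_le)
      fun i => by rw [edist_eq_enorm_sub]; exact h i
  have h3 := h2.ennrpow_const (1 / 2 : ℝ)
  rw [ENNReal.zero_rpow_of_pos (by norm_num)] at h3
  refine h3.congr fun i => ?_
  rw [← ENNReal.rpow_natCast, ← ENNReal.rpow_mul]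
  norm_num

theorem IsH1On.sub [I.OrdConnected] (h₁ : IsH1On I f₁ g₁) (h₂ : IsH1On I f₂ g₂) :
    IsH1On I (f₁ - f₂) (g₁ - g₂) := by
  have h := h₁.comb h₂ 1 (-1)
  have e : ∀ a b : ℝ → 𝕜, (fun x => 1 * a x + -1 * b x) = a - b := by
    intro a b; funext x; simp [sub_eq_add_neg]
  rwa [e, e] at h

theorem exists_memLp_limit {μ : Measure ℝ} {f : ℕ → ℝ → 𝕜} (hf : ∀ n, MemLp (f n) 2 μ)
    (hc : ∀ ε > 0, ∃ N, ∀ n ≥ N, ∀ m ≥ N, ∫⁻ x, ‖(f n - f m) x‖ₑ ^ 2 ∂μ ≤ ε) :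
    ∃ F : ℝ → 𝕜, MemLp F 2 μ ∧ Tendsto (fun n => eLpNorm (f n - F) 2 μ) atTop (𝓝 0) := by
  have hcs : CauchySeq fun n => (hf n).toLp (f n) := by
    rw [EMetric.cauchySeq_iff]
    intro ε hε
    obtain ⟨δ, hδ0, hδ⟩ := exists_between hε
    obtain ⟨N, hN⟩ := hc (δ ^ 2) (pos_iff_ne_zero.2 (pow_ne_zero 2 hδ0.ne'))
    refine ⟨N, fun n hn m hm => lt_of_le_of_lt ?_ hδ⟩
    rw [Lp.edist_toLp_toLp]
    have := hN n hn m hm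
    rw [← eLpNorm_two_sq] at this
    exact (ENNReal.pow_right_strictMono two_ne_zero).le_iff_le.1 this
  obtain ⟨L, hL⟩ := cauchySeq_tendsto_of_complete hcs
  refine ⟨L, Lp.memLp L, ?_⟩
  rw [tendsto_iff_edist_tendsto_0] at hL
  refine hL.congr fun n => ?_
  rw [← Lp.edist_toLp_toLp _ _ (hf n) (Lp.memLp L), Lp.toLp_coeFn]

/-- Completeness of `H¹(I)`. -/
theorem exists_isH1On_limit [I.OrdConnected] (hI : MeasurableSet I) {ℓ : ℝ} (hℓ : 0 < ℓ)
    (hlen : ∀ x ∈ I, ∃ a, Set.Icc a (a + ℓ) ⊆ I ∧ x ∈ Set.Icc a (a + ℓ))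
    {f g : ℕ → ℝ → 𝕜} (h : ∀ n, IsH1On I (f n) (g n))
    (hc : ∀ ε > 0, ∃ N, ∀ n ≥ N, ∀ m ≥ N, energyOn I (f n - f m) (g n - g m) ≤ ε) :
    ∃ F G : ℝ → 𝕜, IsH1On I F G ∧ (∀ x ∈ I, Tendsto (fun n => f n x) atTop (𝓝 (F x))) ∧
      Tendsto (fun n => energyOn I (f n - F) (g n - G)) atTop (𝓝 0) := by
  classical
  obtain ⟨F₀, hF₀, hF₀t⟩ := exists_memLp_limit (fun n => (h n).memLp_fn) fun ε hε =>
    (hc ε hε).imp fun N hN n hn m hm =>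
      (lintegral_fn_le_energyOn I (f n - f m) (g n - g m)).trans (hN n hn m hm)
  obtain ⟨G, hG, hGt⟩ := exists_memLp_limit (fun n => (h n).memLp_der) fun ε hε =>
    (hc ε hε).imp fun N hN n hn m hm =>
      (lintegral_der_le_energyOn I (f n - f m) (g n - g m)).trans (hN n hn m hm)
  -- The sup bound applied to differences gives a limit at every point, not just almost everywhere;
  -- the vertex conditions on G depend on this.
  have hpt : ∀ x ∈ I, ∃ y, Tendsto (fun n => f n x) atTop (𝓝 y) := by
    intro x hx
    obtain ⟨a, ha, hxa⟩ := hlen x hx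
    refine cauchySeq_tendsto_of_complete (EMetric.cauchySeq_iff.2 fun ε hε => ?_)
    obtain ⟨δ, hδ0, hδ⟩ := exists_between hε
    have hK := supConst_ne_top hℓ
    have hK0 : supConst ℓ ≠ 0 := by simp [supConst]
    obtain ⟨N, hN⟩ := hc (δ ^ 2 / supConst ℓ)
      (ENNReal.div_pos (pow_ne_zero 2 hδ0.ne') hK)
    refine ⟨N, fun n hn m hm => lt_of_le_of_lt ?_ hδ⟩
    rw [edist_eq_enorm_sub]
    refine (ENNReal.pow_right_strictMono two_ne_zero).le_iff_le.1 ?_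
    refine (((h n).sub (h m)).enorm_sq_le hℓ ha hxa).trans ?_
    refine (mul_le_mul_right (hN n hn m hm) _).trans ?_
    rw [ENNReal.mul_div_cancel hK0 hK]
  choose! F hF using hpt
  -- An almost everywhere convergent subsequence identifies the L² limit with the pointwise limit.
  have hae : ∀ᵐ x ∂volume.restrict I, F₀ x = F x := by
    obtain ⟨ns, hns, hlim⟩ := (tendstoInMeasure_of_tendsto_eLpNorm two_ne_zero
      (fun n => (h n).memLp_fn.1) hF₀.1 hF₀t).exists_seq_tendsto_ae
    filter_upwards [hlim, ae_restrict_mem hI] with x hx hxI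
    exact tendsto_nhds_unique hx ((hF x hxI).comp hns.tendsto_atTop)
  have hFm : MemLp F 2 (volume.restrict I) := hF₀.ae_eq hae
  have hFt : Tendsto (fun n => eLpNorm (f n - F) 2 (volume.restrict I)) atTop (𝓝 0) := by
    refine hF₀t.congr fun n => eLpNorm_congr_ae ?_
    filter_upwards [hae] with x hx
    simp [hx]
  have hsq : ∀ {k : ℕ → ℝ → 𝕜} {K : ℝ → 𝕜},
      Tendsto (fun n => eLpNorm (k n - K) 2 (volume.restrict I)) atTop (𝓝 0) →
      Tendsto (fun n => ∫⁻ x in I, ‖(k n - K) x‖ₑ ^ 2) atTop (𝓝 0) := by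
    intro k K hk
    have := ENNReal.Tendsto.pow (n := 2) hk
    simpa [eLpNorm_two_sq] using this
  have hprim : ∀ x ∈ I, ∀ y ∈ I, F y - F x = ∫ t in x..y, G t := by
    intro x hx y hy
    refine tendsto_nhds_unique ((hF y hy).sub (hF x hx)) ?_
    have hb : Tendsto (fun n => ENNReal.ofReal |y - x| * ∫⁻ t in I, ‖(g n - G) t‖ₑ ^ 2) atTop
        (𝓝 0) := by
      simpa using ENNReal.Tendsto.const_mul (hsq hGt) (.inr ENNReal.ofReal_ne_top)
    refine tendsto_of_enorm_sq_le (fun n => ?_) hb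
    rw [(h n).primitive x hx y hy, ← intervalIntegral.integral_sub
      (intervalIntegrable_of_memLp (h n).memLp_der hx hy) (intervalIntegrable_of_memLp hG hx hy)]
    exact enorm_integral_sq_le ((h n).memLp_der.sub hG) hx hy
  have hFG : IsH1On I F G := ⟨hFm, hG, hprim⟩
  refine ⟨F, G, hFG, hF, ?_⟩
  have := (hsq hGt).add (hsq hFt)
  rw [add_zero] at this
  refine this.congr fun n => ?_
  rw [((h n).sub hFG).energyOn_eq]

/-- Interpolation |f|^p = |f|^(p-2) |f|². Here p > 2 turns uniform smallness at bounded energy into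
smallness in L^p. -/
theorem powOn_le_of_enorm_le (hp : 2 < p) {s : ℝ≥0∞} (hs : s ≠ ⊤) (hI : MeasurableSet I)
    (h : ∀ x ∈ I, ‖f x‖ₑ ≤ s) (g : ℝ → 𝕜) : powOn p I f ≤ s ^ (p - 2) * energyOn I f g := by
  have : powOn p I f ≤ ∫⁻ x in I, s ^ (p - 2) * (‖g x‖ₑ ^ 2 + ‖f x‖ₑ ^ 2) := by
    refine setLIntegral_mono' hI fun x hx => ?_
    calc ‖f x‖ₑ ^ p = ‖f x‖ₑ ^ (p - 2) * ‖f x‖ₑ ^ 2 := by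
          rw [← ENNReal.rpow_natCast, ← ENNReal.rpow_add_of_nonneg _ _ (by linarith) (by simp)]
          congr 1; push_cast; ring
      _ ≤ _ := by
          gcongr
          · exact h x hx
          · exact le_add_self
  rw [lintegral_const_mul' _ _ (ENNReal.rpow_ne_top_of_nonneg (by linarith) hs)] at this
  exact this

/-- Convexity of x ↦ x^q applied to w·(a/w) + w'·(b/w'). With w close to 1 it replaces the triangle
inequality in L^q and avoids taking roots. -/
theorem ENNReal.add_rpow_le_weighted {w w' : ℝ≥0∞} (hw : w + w' = 1) (hw0 : w ≠ 0) (hw0' : w' ≠ 0)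
    {q : ℝ} (hq : 1 ≤ q) (a b : ℝ≥0∞) :
    (a + b) ^ q ≤ w ^ (1 - q) * a ^ q + w' ^ (1 - q) * b ^ q := by
  have key : ∀ {v : ℝ≥0∞}, v ≠ 0 → v ≠ ⊤ → ∀ c : ℝ≥0∞,
      v * (v⁻¹ * c) = c ∧ v * (v⁻¹ * c) ^ q = v ^ (1 - q) * c ^ q := by
    intro v h0 ht c
    refine ⟨by rw [← mul_assoc, ENNReal.mul_inv_cancel h0 ht, one_mul], ?_⟩
    rw [ENNReal.mul_rpow_of_nonneg _ _ (by linarith), ← mul_assoc, ENNReal.inv_rpow,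
      ← ENNReal.rpow_neg, sub_eq_add_neg, ENNReal.rpow_add _ _ h0 ht, ENNReal.rpow_one]
  have hwt : w ≠ ⊤ := by rintro rfl; simp at hw
  have hwt' : w' ≠ ⊤ := by rintro rfl; simp at hw
  have := ENNReal.rpow_arith_mean_le_arith_mean2_rpow w w' (w⁻¹ * a) (w'⁻¹ * b) hw hq
  rwa [(key hw0 hwt a).1, (key hw0 hwt a).2, (key hw0' hwt' b).1, (key hw0' hwt' b).2] at this

end OneVariable

/-- Around each of its points, `I` contains an interval of length `ℓ`. -/
def HasRoom (I : Set ℝ) (ℓ : ℝ) : Prop :=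
  ∀ x ∈ I, ∃ a, Set.Icc a (a + ℓ) ⊆ I ∧ x ∈ Set.Icc a (a + ℓ)

/-- The intervals `[0, ∞)` and `[0, ℓ]` with `ℓ > 0`. -/
def IsEdgeInterval (I : Set ℝ) : Prop := I = Set.Ici 0 ∨ ∃ ℓ > 0, I = Set.Icc 0 ℓ

namespace IsEdgeInterval

variable {I : Set ℝ}

theorem measurableSet (h : IsEdgeInterval I) : MeasurableSet I := by
  rcases h with rfl | ⟨ℓ, -, rfl⟩
  exacts [measurableSet_Ici, measurableSet_Icc]

theorem ordConnected (h : IsEdgeInterval I) : I.OrdConnected := by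
  rcases h with rfl | ⟨ℓ, -, rfl⟩
  exacts [Set.ordConnected_Ici, Set.ordConnected_Icc]

theorem exists_hasRoom (h : IsEdgeInterval I) : ∃ ℓ > 0, HasRoom I ℓ := by
  rcases h with rfl | ⟨ℓ, hℓ, rfl⟩
  · refine ⟨1, one_pos, fun x hx => ⟨x, ?_, ?_⟩⟩
    · exact fun y hy => le_trans hx hy.1
    · simp
  · exact ⟨ℓ, hℓ, fun x hx => ⟨0, by simp, by simpa using hx⟩⟩

theorem nonneg (h : IsEdgeInterval I) {x : ℝ} (hx : x ∈ I) : 0 ≤ x := by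
  rcases h with rfl | ⟨ℓ, -, rfl⟩
  exacts [hx, hx.1]

theorem mem_of_le (h : IsEdgeInterval I) {x y : ℝ} (hx : x ∈ I) (hy : 0 ≤ y) (hyx : y ≤ x) :
    y ∈ I := by
  rcases h with rfl | ⟨ℓ, -, rfl⟩
  exacts [hy, ⟨hy, hyx.trans hx.2⟩]

end IsEdgeInterval

/-! ### Functions on the graph, and parts of the graph parametrised by an interval. -/

namespace MetricGraph

variable {V E : Type*} {G : MetricGraph V E} {𝕜 : Type*} [RCLike 𝕜]

theorem interval_of_top {e : E} (h : G.len e = ⊤) : G.interval e = Set.Ici 0 := by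
  ext x; simp [interval, h]

theorem interval_of_ne_top {e : E} (h : G.len e ≠ ⊤) :
    G.interval e = Set.Icc 0 (G.len e).toReal := by
  ext x
  simp only [interval, Set.mem_ofPred_eq, Set.mem_Icc, and_congr_right_iff]
  intro _
  exact ENNReal.ofReal_le_iff_le_toReal h

theorem isEdgeInterval_interval (G : MetricGraph V E) (e : E) :
    IsEdgeInterval (G.interval e) := by
  by_cases h : G.len e = ⊤
  · exact .inl (interval_of_top h)
  · exact .inr ⟨_, ENNReal.toReal_pos (G.len_pos e).ne' h, interval_of_ne_top h⟩

instance (e : E) : (G.interval e).OrdConnected := (G.isEdgeInterval_interval e).ordConnected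

theorem pos_mem_interval (a : G.EdgeEnd) : G.pos a ∈ G.interval (G.edge a) := by
  rcases a with e | e
  · simp [pos, edge, interval]
  · simp [pos, edge, interval_of_ne_top e.2]

theorem _root_.IsH1On.aemeasurable_energy {I : Set ℝ} {f g : ℝ → 𝕜} (h : IsH1On I f g) :
    AEMeasurable (fun x => ‖g x‖ₑ ^ 2 + ‖f x‖ₑ ^ 2) (volume.restrict I) :=
  h.aemeasurable_der.add h.aemeasurable_fn

theorem energyOn_comb_le (I : Set ℝ) (a b : 𝕜) (f₁ g₁ f₂ g₂ : ℝ → 𝕜)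
    (h₁ : IsH1On I f₁ g₁) :
    energyOn I (fun x => a * f₁ x + b * f₂ x) (fun x => a * g₁ x + b * g₂ x) ≤
      2 * ‖a‖ₑ ^ 2 * energyOn I f₁ g₁ + 2 * ‖b‖ₑ ^ 2 * energyOn I f₂ g₂ := by
  unfold energyOn
  rw [← lintegral_const_mul' _ _ (by finiteness), ← lintegral_const_mul' _ _ (by finiteness),
    ← lintegral_add_left' (h₁.aemeasurable_energy.const_mul _)]
  refine lintegral_mono fun x => ?_
  have h := fun y z : 𝕜 => enorm_add_sq_le (a * y) (b * z)
  simp only [enorm_mul, mul_pow] at h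
  refine (add_le_add (h (g₁ x) (g₂ x)) (h (f₁ x) (f₂ x))).trans (le_of_eq ?_)
  ring

theorem energy_comb_le (a b : 𝕜) (u w : G.H10 𝕜) :
    G.energy (fun e x => a * u.fn e x + b * w.fn e x) (fun e x => a * u.der e x + b * w.der e x) ≤
      2 * ‖a‖ₑ ^ 2 * u.normSq + 2 * ‖b‖ₑ ^ 2 * w.normSq := by
  unfold H10.normSq energy
  rw [← ENNReal.tsum_mul_left, ← ENNReal.tsum_mul_left, ← ENNReal.tsum_add]
  exact ENNReal.tsum_le_tsum fun e => energyOn_comb_le _ _ _ _ _ _ _ (u.isH1On e)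

namespace H10

/-- The linear combination `a u + b w`. -/
def comb (a b : 𝕜) (u w : G.H10 𝕜) : G.H10 𝕜 where
  fn e x := a * u.fn e x + b * w.fn e x
  der e x := a * u.der e x + b * w.der e x
  isH1On e := (u.isH1On e).comb (w.isH1On e) a b
  continuous_at_vertices x y h := by
    simp only [u.continuous_at_vertices x y h, w.continuous_at_vertices x y h]
  dirichlet x h := by simp [u.dirichlet x h, w.dirichlet x h]
  energy_lt_top := by
    refine (energy_comb_le a b u w).trans_lt ?_
    have := u.energy_lt_top
    have := w.energy_lt_top
    unfold normSq
    finiteness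

/-- The zero function. -/
def zero (G : MetricGraph V E) (𝕜 : Type*) [RCLike 𝕜] : G.H10 𝕜 where
  fn _ := 0
  der _ := 0
  isH1On _ := IsH1On.zero _
  continuous_at_vertices := by simp
  dirichlet := by simp
  energy_lt_top := by simp [energy, energyOn]

/-- Change a function on a set of edges, keeping its value at the ends or changing it consistently
at vertices that are not outer. -/
def replace (u : G.H10 𝕜) (R : Set E) (F D : E → ℝ → 𝕜)
    (hF : ∀ e ∈ R, IsH1On (G.interval e) (F e) (D e))
    (hoff : ∀ e ∉ R, F e = u.fn e ∧ D e = u.der e)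
    (hE : ∑' e : R, energyOn (G.interval e) (F e) (D e) < ⊤)
    (hval : ∀ a : G.EdgeEnd, F (G.edge a) (G.pos a) = u.fn (G.edge a) (G.pos a) ∨
      (¬ G.IsOuter (G.vert a) ∧ ∀ b : G.EdgeEnd, G.vert b = G.vert a →
        F (G.edge b) (G.pos b) = F (G.edge a) (G.pos a))) : G.H10 𝕜 where
  fn := F
  der := D
  isH1On e := by
    by_cases he : e ∈ R
    · exact hF e he
    · rw [(hoff e he).1, (hoff e he).2]
      exact u.isH1On e
  continuous_at_vertices a b hab := by
    rcases hval a with ha | ⟨-, ha⟩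
    · rcases hval b with hb | ⟨-, hb⟩
      · rw [ha, hb, u.continuous_at_vertices a b hab]
      · exact hb a hab
    · exact (ha b hab.symm).symm
  dirichlet a ha := by
    rcases hval a with h | ⟨h, -⟩
    · rw [h, u.dirichlet a ha]
    · exact absurd ha h
  energy_lt_top := by
    unfold energy
    rw [← ENNReal.summable.tsum_add_tsum_compl (s := R) ENNReal.summable]
    refine ENNReal.add_lt_top.2 ⟨hE, lt_of_le_of_lt ?_ u.energy_lt_top⟩
    refine (ENNReal.tsum_le_tsum fun e : (Rᶜ : Set E) => ?_).trans
      (ENNReal.tsum_comp_le_tsum_of_injective Subtype.val_injective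
        fun e => energyOn (G.interval e) (u.fn e) (u.der e))
    rw [(hoff e.1 e.2).1, (hoff e.1 e.2).2]

end H10

/-- A set of edges of `G` that is isometrically parametrised by an interval `dom`, so that the
functions in `H¹₀(G)` are pulled back to functions in `H¹(dom)`. -/
structure Part (𝕜 : Type*) [RCLike 𝕜] (G : MetricGraph V E) where
  dom : Set ℝ
  carrier : Set E
  edgeAt : ℝ → E
  coord : ℝ → ℝ
  sign : ℝ → ℝ
  isEdgeInterval : IsEdgeInterval dom
  sign_cases : ∀ x, sign x = 1 ∨ sign x = -1
  lintegral_eq : ∀ h : E → ℝ → ℝ≥0∞, ∫⁻ x in dom, h (edgeAt x) (coord x) =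
    ∑' e : carrier, ∫⁻ x in G.interval e, h e x
  isH1On : ∀ u : G.H10 𝕜, IsH1On dom (fun x => u.fn (edgeAt x) (coord x))
    (fun x => (sign x : 𝕜) * u.der (edgeAt x) (coord x))

namespace Part

variable (P : Part 𝕜 G)

/-- The pull-back of a function on `G`. -/
def pull (f : E → ℝ → 𝕜) (x : ℝ) : 𝕜 := f (P.edgeAt x) (P.coord x)

/-- The pull-back of the derivative of a function on `G`. -/
def pullDer (g : E → ℝ → 𝕜) (x : ℝ) : 𝕜 := (P.sign x : 𝕜) * g (P.edgeAt x) (P.coord x)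

instance : P.dom.OrdConnected := P.isEdgeInterval.ordConnected

theorem isH1On_pull (u : G.H10 𝕜) : IsH1On P.dom (P.pull u.fn) (P.pullDer u.der) := P.isH1On u

theorem enorm_sign (x : ℝ) : ‖(P.sign x : 𝕜)‖ₑ = 1 := by
  rcases P.sign_cases x with h | h <;> simp [h]

theorem energyOn_pull (f g : E → ℝ → 𝕜) : energyOn P.dom (P.pull f) (P.pullDer g) =
    ∑' e : P.carrier, energyOn (G.interval e) (f e) (g e) := by
  have := P.lintegral_eq fun e x => ‖g e x‖ₑ ^ 2 + ‖f e x‖ₑ ^ 2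
  unfold energyOn
  rw [← this]
  refine lintegral_congr fun x => ?_
  rw [pull, pullDer, enorm_mul, enorm_sign, one_mul]

theorem powOn_pull (p : ℝ) (f : E → ℝ → 𝕜) : powOn p P.dom (P.pull f) =
    ∑' e : P.carrier, powOn p (G.interval e) (f e) :=
  P.lintegral_eq fun e x => ‖f e x‖ₑ ^ p

theorem energy_eq (f g : E → ℝ → 𝕜) : G.energy f g = energyOn P.dom (P.pull f) (P.pullDer g) +
    ∑' e : (P.carrierᶜ : Set E), energyOn (G.interval e) (f e) (g e) := by
  rw [energyOn_pull]
  exact (ENNReal.summable.tsum_add_tsum_compl ENNReal.summable).symm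

theorem powInt_eq (p : ℝ) (u : G.H10 𝕜) : u.powInt p = powOn p P.dom (P.pull u.fn) +
    ∑' e : (P.carrierᶜ : Set E), powOn p (G.interval e) (u.fn e) := by
  rw [powOn_pull]
  exact (ENNReal.summable.tsum_add_tsum_compl ENNReal.summable).symm

theorem energyOn_pull_le (f g : E → ℝ → 𝕜) :
    energyOn P.dom (P.pull f) (P.pullDer g) ≤ G.energy f g := by
  rw [P.energy_eq]
  exact le_self_add

/-- A part of `G` is a ray if it looks like a half-line: a function on it can be changed freely,
apart from its value at the origin. -/
structure IsRay : Prop where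
  dom_eq : P.dom = Set.Ici 0
  exists_extension : ∀ (u : G.H10 𝕜) (φ ψ : ℝ → 𝕜), IsH1On (Set.Ici 0) φ ψ →
    φ 0 = P.pull u.fn 0 → ∃ v : G.H10 𝕜,
      (∀ e ∉ P.carrier, v.fn e = u.fn e ∧ v.der e = u.der e) ∧
      ∀ x, 0 ≤ x → P.pull v.fn x = φ x ∧ P.pullDer v.der x = ψ x

/-- A single edge. -/
def ofEdge (𝕜 : Type*) [RCLike 𝕜] (G : MetricGraph V E) (e : E) : Part 𝕜 G where
  dom := G.interval e
  carrier := {e}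
  edgeAt _ := e
  coord x := x
  sign _ := 1
  isEdgeInterval := G.isEdgeInterval_interval e
  sign_cases _ := .inl rfl
  lintegral_eq h := (tsum_singleton e fun e => ∫⁻ x in G.interval e, h e x).symm
  isH1On u := by simpa using u.isH1On e

/-- An infinite edge has a single end, at coordinate 0, and there the value is prescribed to be that
of u; all vertex conditions are inherited from u. -/
theorem isRay_ofEdge {e : E} (he : G.len e = ⊤) : (ofEdge 𝕜 G e).IsRay where
  dom_eq := interval_of_top he
  exists_extension u φ ψ h h0 := by
    classical
    have hu : ∀ e' ∉ ({e} : Set E), Function.update u.fn e φ e' = u.fn e' ∧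
        Function.update u.der e ψ e' = u.der e' := fun e' he' => by
      simp [Function.update_of_ne (show e' ≠ e from he')]
    refine ⟨u.replace {e} (Function.update u.fn e φ) (Function.update u.der e ψ) ?_ hu ?_ ?_,
      hu, ?_⟩
    · rintro _ rfl
      simpa [interval_of_top he] using h
    · rw [tsum_singleton e fun e' => energyOn (G.interval e') (Function.update u.fn e φ e')
        (Function.update u.der e ψ e')]
      simpa [interval_of_top he] using h.energyOn_lt_top
    · intro a
      left
      by_cases ha : G.edge a = e
      · rcases a with e' | e'
        · obtain rfl : e' = e := ha
          simpa [edge, pos, pull, ofEdge] using h0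
        · obtain rfl : e'.1 = e := ha
          exact absurd he e'.2
      · rw [Function.update_of_ne ha]
    · intro x _
      simp [pull, pullDer, ofEdge, H10.replace]

end Part

end MetricGraph

theorem IsH1On.of_split {𝕜 : Type*} [RCLike 𝕜] {A : Set ℝ} [A.OrdConnected] {t : ℝ} {f g : ℝ → 𝕜}
    (htA : t ∈ A) (h₁ : IsH1On (A ∩ Set.Iic t) f g) (h₂ : IsH1On (A ∩ Set.Ici t) f g) :
    IsH1On A f g := by
  have h := IsH1On.glue htA h₁ h₂ rfl
  have e : ∀ k : ℝ → 𝕜, _root_.glue t k k = k := fun k => funext fun x => ite_self _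
  rwa [e, e] at h

theorem IsH1On.singleton {𝕜 : Type*} [RCLike 𝕜] (x : ℝ) (f g : ℝ → 𝕜) :
    IsH1On {x} f g where
  memLp_fn := by simp [Measure.restrict_eq_zero.2 (Real.volume_singleton (a := x))]
  memLp_der := by simp [Measure.restrict_eq_zero.2 (Real.volume_singleton (a := x))]
  primitive := by simp

namespace MetricGraph

variable {V E : Type*} {G : MetricGraph V E} {𝕜 : Type*} [RCLike 𝕜]

/-! ### Chains of bounded edges as half-lines. -/

section Chain

variable (c : ℕ → {e : E // G.len e ≠ ⊤} × Bool)

/-- The length of an edge of a chain. -/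
def chainLen (n : ℕ) : ℝ := (G.len (c n).1.1).toReal

/-- The distance of the `n`-th vertex of a chain from its origin. -/
noncomputable def chainPos (n : ℕ) : ℝ := ∑ k ∈ Finset.range n, chainLen c k

/-- The direction in which a chain traverses its `n`-th edge. -/
noncomputable def chainSign (n : ℕ) : ℝ := if (c n).2 then 1 else -1

/-- The coordinate on the `n`-th edge of a chain, as a function of the distance from the origin, is
`x ↦ chainOff n + chainSign n * x`. -/
noncomputable def chainOff (n : ℕ) : ℝ := if (c n).2 then -chainPos c n else chainPos c (n + 1)

/-- The distance from the origin, as a function of the coordinate on the `n`-th edge of a chain, is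
`x ↦ chainBase n + chainSign n * x`. -/
noncomputable def chainBase (n : ℕ) : ℝ := if (c n).2 then chainPos c n else chainPos c (n + 1)

/-- The index of the edge of a chain at distance `x` from the origin. -/
noncomputable def chainIdx (x : ℝ) : ℕ := sInf {n | x < chainPos c (n + 1)}

theorem chainLen_pos (n : ℕ) : 0 < chainLen c n :=
  ENNReal.toReal_pos (G.len_pos _).ne' (c n).1.2

theorem chainPos_zero : chainPos c 0 = 0 := by simp [chainPos]

theorem chainPos_succ (n : ℕ) : chainPos c (n + 1) = chainPos c n + chainLen c n :=
  Finset.sum_range_succ _ _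

theorem chainPos_strictMono : StrictMono (chainPos c) :=
  strictMono_nat_of_lt_succ fun n => by linarith [chainPos_succ c n, chainLen_pos c n]

theorem chainPos_nonneg (n : ℕ) : 0 ≤ chainPos c n := by
  rw [← chainPos_zero c]; exact (chainPos_strictMono c).monotone (Nat.zero_le n)

theorem chainSign_cases (n : ℕ) : chainSign c n = 1 ∨ chainSign c n = -1 := by
  unfold chainSign; split_ifs <;> simp

theorem chainBase_off (n : ℕ) (x : ℝ) :
    chainBase c n + chainSign c n * (chainOff c n + chainSign c n * x) = x := by
  unfold chainBase chainSign chainOff; split_ifs <;> ring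

theorem chainIdx_eq {n : ℕ} {x : ℝ} (hx : x ∈ Set.Ico (chainPos c n) (chainPos c (n + 1))) :
    chainIdx c x = n := by
  refine le_antisymm (Nat.sInf_le hx.2) (le_csInf ⟨n, hx.2⟩ fun m hm => ?_)
  by_contra! h
  have := (chainPos_strictMono c).monotone (show m + 1 ≤ n from h)
  exact absurd (lt_of_lt_of_le hm this) (not_lt.2 hx.1)

theorem preimage_chainOff (n : ℕ) :
    (fun x => chainOff c n + chainSign c n * x) ⁻¹' G.interval (c n).1.1 =
      Set.Icc (chainPos c n) (chainPos c (n + 1)) := by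
  ext x
  rw [interval_of_ne_top (c n).1.2, ← chainLen]
  have := chainPos_succ c n
  unfold chainOff chainSign
  simp only [Set.mem_preimage, Set.mem_Icc]
  split_ifs <;> constructor <;> rintro ⟨h1, h2⟩ <;> constructor <;> linarith

theorem preimage_chainBase (n : ℕ) :
    (fun x => chainBase c n + chainSign c n * x) ⁻¹'
      Set.Icc (chainPos c n) (chainPos c (n + 1)) = G.interval (c n).1.1 := by
  ext x
  rw [interval_of_ne_top (c n).1.2, ← chainLen]
  have := chainPos_succ c n
  unfold chainBase chainSign
  simp only [Set.mem_preimage, Set.mem_Icc]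
  split_ifs <;> constructor <;> rintro ⟨h1, h2⟩ <;> constructor <;> linarith

theorem edge_startEnd (d : {e : E // G.len e ≠ ⊤} × Bool) : G.edge (G.startEnd d) = d.1.1 := by
  unfold startEnd edge; split_ifs <;> rfl

theorem edge_finishEnd (d : {e : E // G.len e ≠ ⊤} × Bool) : G.edge (G.finishEnd d) = d.1.1 := by
  unfold finishEnd edge; split_ifs <;> rfl

theorem pos_startEnd (n : ℕ) :
    G.pos (G.startEnd (c n)) = chainOff c n + chainSign c n * chainPos c n := by
  have := chainPos_succ c n
  unfold startEnd pos chainOff chainSign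
  split_ifs
  · simp
  · simp only [Sum.elim_inr]; rw [this, chainLen]; ring

theorem pos_finishEnd (n : ℕ) :
    G.pos (G.finishEnd (c n)) = chainOff c n + chainSign c n * chainPos c (n + 1) := by
  have := chainPos_succ c n
  unfold finishEnd pos chainOff chainSign
  split_ifs
  · simp only [Sum.elim_inr]; rw [this, chainLen]; ring
  · simp

theorem eq_startEnd_or_eq_finishEnd {a : G.EdgeEnd} {d : {e : E // G.len e ≠ ⊤} × Bool}
    (h : G.edge a = d.1.1) : a = G.startEnd d ∨ a = G.finishEnd d := by
  rcases d with ⟨e, _ | _⟩ <;> rcases a with e' | e' <;> simp_all [edge, startEnd, finishEnd, Subtype.ext_iff]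

end Chain

namespace IsHalfLineChain

variable {c : ℕ → {e : E // G.len e ≠ ⊤} × Bool}

theorem edge_injective (hc : G.IsHalfLineChain c) : Function.Injective fun n => (c n).1.1 :=
  fun _ _ h => hc.injective (Subtype.ext h)

theorem exists_lt_chainPos (hc : G.IsHalfLineChain c) (x : ℝ) : ∃ n, x < chainPos c n := by
  by_contra! h
  have h1 : ∑' n, G.len (c n).1.1 ≤ ENNReal.ofReal x := by
    rw [ENNReal.tsum_eq_iSup_nat]
    refine iSup_le fun n => ?_
    calc ∑ k ∈ Finset.range n, G.len (c k).1.1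
        = ∑ k ∈ Finset.range n, ENNReal.ofReal (chainLen c k) :=
          Finset.sum_congr rfl fun k _ => (ENNReal.ofReal_toReal (c k).1.2).symm
      _ = ENNReal.ofReal (chainPos c n) :=
          (ENNReal.ofReal_sum_of_nonneg fun k _ => (chainLen_pos c k).le).symm
      _ ≤ _ := ENNReal.ofReal_le_ofReal (h n)
  rw [hc.infinite_length] at h1
  exact absurd h1 (by simp)

theorem iUnion_Ico (hc : G.IsHalfLineChain c) : ⋃ n, Set.Ico (chainPos c n) (chainPos c (n + 1)) = Set.Ici 0 := by
  have := iUnion_Ico_map_succ_eq_Ici (f := chainPos c)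
    (fun n => (chainPos_strictMono c).monotone bot_le) (by
      rw [not_bddAbove_iff]
      intro x
      obtain ⟨n, hn⟩ := hc.exists_lt_chainPos x
      exact ⟨_, ⟨n, rfl⟩, hn⟩)
  simpa [chainPos_zero] using this

theorem iUnion_Icc (hc : G.IsHalfLineChain c) : Set.Ici 0 = ⋃ n, Set.Icc 0 (chainPos c n) := by
  ext x
  simp only [Set.mem_Ici, Set.mem_iUnion, Set.mem_Icc]
  refine ⟨fun hx => ?_, fun ⟨_, h⟩ => h.1⟩
  obtain ⟨n, hn⟩ := hc.exists_lt_chainPos x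
  exact ⟨n, hx, hn.le⟩

/-- The half-open intervals between consecutive vertices tile [0, ∞), and each is mapped
isometrically to its edge up to an end. Distinctness of the edges turns the sum over the carrier
into a sum over n. -/
theorem lintegral_eq (hc : G.IsHalfLineChain c) (h : E → ℝ → ℝ≥0∞) :
    ∫⁻ x in Set.Ici 0, h (c (chainIdx c x)).1.1
      (chainOff c (chainIdx c x) + chainSign c (chainIdx c x) * x) =
    ∑' e : Set.range fun n => (c n).1.1, ∫⁻ x in G.interval e, h e x := by
  rw [tsum_range (g := fun n => (c n).1.1) (fun e => ∫⁻ x in G.interval e, h e x)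
    hc.edge_injective, ← hc.iUnion_Ico, lintegral_iUnion
    (s := fun n => Set.Ico (chainPos c n) (chainPos c (n + 1))) (fun _ => measurableSet_Ico)
    (chainPos_strictMono c).monotone.pairwise_disjoint_on_Ico_succ]
  refine tsum_congr fun n => ?_
  rw [← setLIntegral_comp_affine (chainOff c n) (chainSign_cases c n) (h (c n).1.1),
    preimage_chainOff, ← setLIntegral_congr Ico_ae_eq_Icc]
  refine setLIntegral_congr_fun measurableSet_Ico fun x hx => ?_
  simp only [chainIdx_eq c hx]

/-- Only the right end of the interval needs an argument: there `chainIdx` has already jumped to n +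
1, and continuity at the vertex makes the two values agree. -/
theorem fn_eq (hc : G.IsHalfLineChain c) (u : G.H10 𝕜) {n : ℕ} {x : ℝ}
    (hx : x ∈ Set.Icc (chainPos c n) (chainPos c (n + 1))) :
    u.fn (c n).1.1 (chainOff c n + chainSign c n * x) =
      u.fn (c (chainIdx c x)).1.1 (chainOff c (chainIdx c x) + chainSign c (chainIdx c x) * x) := by
  rcases hx.2.lt_or_eq with h | h
  · rw [chainIdx_eq c ⟨hx.1, h⟩]
  · have h' : chainIdx c x = n + 1 :=
      chainIdx_eq c ⟨h.ge, h ▸ chainPos_strictMono c (Nat.lt_succ_self (n + 1))⟩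
    have := u.continuous_at_vertices _ _ (hc.consecutive n)
    rw [edge_finishEnd, edge_startEnd, pos_finishEnd, pos_startEnd, ← h] at this
    rw [h', this]

theorem isH1On (hc : G.IsHalfLineChain c) (u : G.H10 𝕜) : IsH1On (Set.Ici 0)
    (fun x => u.fn (c (chainIdx c x)).1.1
      (chainOff c (chainIdx c x) + chainSign c (chainIdx c x) * x))
    (fun x => (chainSign c (chainIdx c x) : 𝕜) * u.der (c (chainIdx c x)).1.1
      (chainOff c (chainIdx c x) + chainSign c (chainIdx c x) * x)) := by
  have hlt : ∀ {k : E → ℝ → 𝕜}, (∀ e, ∫⁻ x in G.interval e, ‖k e x‖ₑ ^ 2 ≤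
      energyOn (G.interval e) (u.fn e) (u.der e)) →
      ∫⁻ x in Set.Ici 0, ‖k (c (chainIdx c x)).1.1
        (chainOff c (chainIdx c x) + chainSign c (chainIdx c x) * x)‖ₑ ^ 2 < ⊤ := by
    intro k hk
    rw [hc.lintegral_eq fun e x => ‖k e x‖ₑ ^ 2]
    refine lt_of_le_of_lt ?_ u.energy_lt_top
    exact (ENNReal.tsum_comp_le_tsum_of_injective Subtype.val_injective
      fun e => ∫⁻ x in G.interval e, ‖k e x‖ₑ ^ 2).trans (ENNReal.tsum_le_tsum hk)
  refine isH1On_of_iUnion (A := fun n => Set.Icc 0 (chainPos c n)) ?_ hc.iUnion_Icc ?_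
    (hlt fun e => lintegral_fn_le_energyOn _ _ _) ?_
  · exact fun m n hmn => Set.Icc_subset_Icc_right ((chainPos_strictMono c).monotone hmn)
  · intro n
    induction n with
    | zero =>
      rw [chainPos_zero, Set.Icc_self]
      exact IsH1On.singleton _ _ _
    | succ n ih =>
      have hle := chainPos_strictMono c (Nat.lt_succ_self n)
      refine IsH1On.of_split (t := chainPos c n) ⟨chainPos_nonneg c n, hle.le⟩ ?_ ?_
      · exact ih.mono fun x hx => ⟨hx.1.1, hx.2⟩
      · have h1 := (u.isH1On (c n).1.1).comp_affine (chainOff c n) (chainSign_cases c n)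
        rw [preimage_chainOff] at h1
        refine IsH1On.mono (I := Set.Icc (chainPos c n) (chainPos c (n + 1))) ?_
          fun x hx => ⟨hx.2, hx.1.2⟩
        refine h1.congr measurableSet_Icc (fun x hx => hc.fn_eq u hx) ?_
        -- The derivatives on adjacent edges need not match at a vertex, but a single point is
        -- negligible.
        have hne : ∀ᵐ x : ℝ, x ≠ chainPos c (n + 1) := by
          simp [ae_iff]
        filter_upwards [hne] with x hx hxI
        rw [chainIdx_eq c ⟨hxI.1, lt_of_le_of_ne hxI.2 hx⟩]
  · have e : ∀ x, ‖(chainSign c (chainIdx c x) : 𝕜)‖ₑ = 1 := fun x => by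
      rcases chainSign_cases c (chainIdx c x) with h | h <;> simp [h]
    simp only [enorm_mul, e, one_mul]
    exact hlt fun e => lintegral_der_le_energyOn _ _ _

end IsHalfLineChain

/-- The half-line formed by a chain. -/
noncomputable def Part.ofChain (𝕜 : Type*) [RCLike 𝕜] {c : ℕ → {e : E // G.len e ≠ ⊤} × Bool}
    (hc : G.IsHalfLineChain c) : Part 𝕜 G where
  dom := Set.Ici 0
  carrier := Set.range fun n => (c n).1.1
  edgeAt x := (c (chainIdx c x)).1.1
  coord x := chainOff c (chainIdx c x) + chainSign c (chainIdx c x) * x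
  sign x := chainSign c (chainIdx c x)
  isEdgeInterval := .inl rfl
  sign_cases _ := chainSign_cases c _
  lintegral_eq := hc.lintegral_eq
  isH1On := hc.isH1On

theorem not_isOuter_of_ne {a b : G.EdgeEnd} (h : G.vert a = G.vert b) (hab : a ≠ b) :
    ¬ G.IsOuter (G.vert a) := fun ⟨_, _, hx⟩ => hab ((hx a rfl).trans (hx b h.symm).symm)

/-- At an inner vertex of the chain there are exactly two ends, both on the chain, so φ carried over
to the edges is single-valued there and no outer vertex interferes. Only the origin can meet the
rest of G, and there φ agrees with u. -/
theorem Part.isRay_ofChain {c : ℕ → {e : E // G.len e ≠ ⊤} × Bool} (hc : G.IsHalfLineChain c) :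
    (Part.ofChain 𝕜 hc).IsRay where
  dom_eq := rfl
  exists_extension u φ ψ h h0 := by
    classical
    set P := Part.ofChain 𝕜 hc
    have hex : ∀ n, ∃ m, (c m).1.1 = (c n).1.1 := fun n => ⟨n, rfl⟩
    -- The chosen index of an edge is its true one because a chain visits no edge twice.
    have hch : ∀ n, (hex n).choose = n := fun n => hc.edge_injective (hex n).choose_spec
    let F : E → ℝ → 𝕜 := fun e => if he : ∃ n, (c n).1.1 = e then
      fun x => φ (chainBase c he.choose + chainSign c he.choose * x) else u.fn e
    let D : E → ℝ → 𝕜 := fun e => if he : ∃ n, (c n).1.1 = e then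
      fun x => (chainSign c he.choose : 𝕜) *
        ψ (chainBase c he.choose + chainSign c he.choose * x) else u.der e
    have hF : ∀ n, F (c n).1.1 = fun x => φ (chainBase c n + chainSign c n * x) := fun n => by
      simp only [F, dif_pos (hex n), hch n]
    have hD : ∀ n, D (c n).1.1 = fun x => (chainSign c n : 𝕜) *
        ψ (chainBase c n + chainSign c n * x) := fun n => by
      simp only [D, dif_pos (hex n), hch n]
    have hoff : ∀ e ∉ P.carrier, F e = u.fn e ∧ D e = u.der e := fun e he => by
      have he' : ¬ ∃ n, (c n).1.1 = e := he
      simp only [F, D, dif_neg he', and_self]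
    have hpull : ∀ x, P.pull F x = φ x ∧ P.pullDer D x = ψ x := by
      intro x
      refine ⟨?_, ?_⟩
      · change F (c (chainIdx c x)).1.1 _ = _
        rw [hF]
        exact congrArg φ (chainBase_off c _ x)
      · change (chainSign c (chainIdx c x) : 𝕜) * D (c (chainIdx c x)).1.1 _ = _
        rw [hD]
        change (chainSign c (chainIdx c x) : 𝕜) * ((chainSign c (chainIdx c x) : 𝕜) *
          ψ (_ + _ * (chainOff c (chainIdx c x) + chainSign c (chainIdx c x) * x))) = _
        rw [chainBase_off, ← mul_assoc]
        rcases chainSign_cases c (chainIdx c x) with h | h <;> simp [h]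
    have hstart : ∀ n, F (G.edge (G.startEnd (c n))) (G.pos (G.startEnd (c n))) =
        φ (chainPos c n) := fun n => by
      rw [edge_startEnd, pos_startEnd, hF]
      exact congrArg φ (chainBase_off c n _)
    have hfinish : ∀ n, F (G.edge (G.finishEnd (c n))) (G.pos (G.finishEnd (c n))) =
        φ (chainPos c (n + 1)) := fun n => by
      rw [edge_finishEnd, pos_finishEnd, hF]
      exact congrArg φ (chainBase_off c n _)
    have hinner : ∀ n, ∀ a : G.EdgeEnd, G.vert a = G.vert (G.finishEnd (c n)) →
        ¬ G.IsOuter (G.vert a) ∧ ∀ b : G.EdgeEnd, G.vert b = G.vert a →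
          F (G.edge b) (G.pos b) = F (G.edge a) (G.pos a) := by
      intro n a ha
      have hval : ∀ b : G.EdgeEnd, G.vert b = G.vert (G.finishEnd (c n)) →
          F (G.edge b) (G.pos b) = φ (chainPos c (n + 1)) := by
        intro b hb
        rcases hc.no_branching n b hb with rfl | rfl
        exacts [hfinish n, hstart (n + 1)]
      refine ⟨?_, fun b hb => by rw [hval a ha, hval b (hb.trans ha)]⟩
      rw [ha]
      refine not_isOuter_of_ne (hc.consecutive n) fun heq => ?_
      have := congrArg G.edge heq
      rw [edge_finishEnd, edge_startEnd] at this
      exact absurd (hc.edge_injective this) (Nat.succ_ne_self n).symm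
    refine ⟨u.replace P.carrier F D ?_ hoff ?_ ?_, hoff, fun x _ => hpull x⟩
    · rintro _ ⟨n, rfl⟩
      have h1 := (h.mono (J := Set.Icc (chainPos c n) (chainPos c (n + 1)))
        fun x hx => (chainPos_nonneg c n).trans hx.1).comp_affine (chainBase c n)
          (chainSign_cases c n)
      rw [preimage_chainBase] at h1
      simpa only [hF, hD] using h1
    · rw [← P.energyOn_pull, funext fun x => (hpull x).1, funext fun x => (hpull x).2]
      exact h.energyOn_lt_top
    · intro a
      by_cases ha : G.edge a ∈ P.carrier
      · obtain ⟨n, hn⟩ := ha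
        rcases eq_startEnd_or_eq_finishEnd hn.symm with rfl | rfl
        · cases n with
          | zero =>
            left
            rw [hstart, chainPos_zero, h0, edge_startEnd, pos_startEnd, chainPos_zero]
            have h00 : chainIdx c 0 = 0 := chainIdx_eq c
              ⟨(chainPos_zero c).le, chainPos_zero c ▸ chainPos_strictMono c zero_lt_one⟩
            change u.fn (c (chainIdx c 0)).1.1 (chainOff c (chainIdx c 0) +
              chainSign c (chainIdx c 0) * 0) = _
            rw [h00]
          | succ n => exact .inr (hinner n _ (hc.consecutive n).symm)
        · exact .inr (hinner n _ rfl)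
      · exact .inl (by rw [(hoff _ ha).1])

/-- A locally finite graph that is unbounded only along half-lines is covered by finitely many
bounded edges and rays. -/
theorem UnboundedOnlyAlongHalfLines.exists_cover (h : G.UnboundedOnlyAlongHalfLines)
    (𝕜 : Type*) [RCLike 𝕜] : ∃ (ι : Type) (_ : Fintype ι) (P : ι → Part 𝕜 G),
      (∀ e, ∃ i, e ∈ (P i).carrier) ∧ ∀ i, (P i).IsRay ∨ ∃ ℓ > 0, (P i).dom = Set.Icc 0 ℓ := by
  classical
  obtain ⟨S, hS, hSc, hfin⟩ := h
  set X := {e : E | ∀ c ∈ S, ∀ n, (c n).1.1 ≠ e}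
  have := hS.fintype
  have := hfin.fintype
  let Q : S ⊕ X → Part 𝕜 G := Sum.elim (fun c => Part.ofChain 𝕜 (hSc c.1 c.2))
    fun e => Part.ofEdge 𝕜 G e.1
  -- The sum type lives in the universe of E; passing to `Fin` yields an index set in `Type`.
  let eqv := Fintype.equivFin (S ⊕ X)
  refine ⟨Fin (Fintype.card (S ⊕ X)), inferInstance, fun i => Q (eqv.symm i), ?_, ?_⟩
  · intro e
    have : ∃ j, e ∈ (Q j).carrier := by
      by_cases he : e ∈ X
      · exact ⟨.inr ⟨e, he⟩, rfl⟩
      · simp only [X, Set.mem_ofPred_eq, not_forall, not_not] at he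
        obtain ⟨c, hc, n, hn⟩ := he
        exact ⟨.inl ⟨c, hc⟩, n, hn⟩
    obtain ⟨j, hj⟩ := this
    exact ⟨eqv j, by simpa using hj⟩
  · intro i
    change (Q (eqv.symm i)).IsRay ∨ ∃ ℓ > 0, (Q (eqv.symm i)).dom = Set.Icc 0 ℓ
    rcases eqv.symm i with c | e
    · exact .inl (Part.isRay_ofChain (hSc c.1 c.2))
    · by_cases he : G.len e.1 = ⊤
      · exact .inl (Part.isRay_ofEdge he)
      · exact .inr ⟨_, ENNReal.toReal_pos (G.len_pos _).ne' he, interval_of_ne_top he⟩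

/-- Without infinite edges and without chains, every edge is exceptional; then there are finitely
many, all of finite length, and G is bounded. -/
theorem UnboundedOnlyAlongHalfLines.exists_isRay (h : G.UnboundedOnlyAlongHalfLines)
    (hG : G.IsUnbounded) (𝕜 : Type*) [RCLike 𝕜] : ∃ P : Part 𝕜 G, P.IsRay := by
  by_cases htop : ∃ e, G.len e = ⊤
  · obtain ⟨e, he⟩ := htop
    exact ⟨_, Part.isRay_ofEdge he⟩
  · push Not at htop
    obtain ⟨S, -, hSc, hfin⟩ := h
    rcases S.eq_empty_or_nonempty with rfl | ⟨c, hc⟩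
    · refine absurd ⟨?_, htop⟩ hG
      simpa [Set.finite_univ_iff] using hfin
    · exact ⟨_, Part.isRay_ofChain (hSc c hc)⟩

end MetricGraph

/-! ### Best constants and the Sobolev inequality on G. -/

theorem ENNReal.le_sInf_mul {S : Set ℝ≥0∞} {a x : ℝ≥0∞} (hS : S.Nonempty) (hx : x ≠ ⊤)
    (h : ∀ C ∈ S, a ≤ C * x) : a ≤ sInf S * x := by
  -- Dividing by x is impossible here, and any admissible C gives a ≤ 0. For empty S the claim would
  -- fail, as ⊤ * 0 = 0.
  by_cases h0 : x = 0
  · obtain ⟨C, hC⟩ := hS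
    simpa [h0] using h C hC
  · rw [← ENNReal.div_le_iff h0 hx]
    exact le_sInf fun C hC => (ENNReal.div_le_iff h0 hx).2 (h C hC)

/-- Finiteness of the constant says that some constant is admissible. In the main argument it is
free, since there C_p(ℝ) < C_p(G). -/
theorem powOn_rpow_le_bestConstLine {𝕜 : Type*} [RCLike 𝕜] {p : ℝ} (hD : bestConstLine 𝕜 p ≠ ⊤)
    {f g : ℝ → 𝕜} (h : IsH1On Set.univ f g) :
    powOn p Set.univ f ^ (2 / p) ≤ bestConstLine 𝕜 p * energyOn Set.univ f g := by
  refine ENNReal.le_sInf_mul ?_ h.energyOn_lt_top.ne fun C hC => hC f g h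
  by_contra hne
  rw [Set.not_nonempty_iff_eq_empty] at hne
  exact hD (by rw [bestConstLine, hne, sInf_empty])

namespace MetricGraph

variable {V E : Type*} {G : MetricGraph V E} {𝕜 : Type*} [RCLike 𝕜] {p : ℝ}
  {ι : Type*} [Fintype ι] {P : ι → Part 𝕜 G}

theorem H10.normSq_ne_top (u : G.H10 𝕜) : u.normSq ≠ ⊤ := u.energy_lt_top.ne

theorem tsum_le_sum_of_cover (hP : ∀ e, ∃ i, e ∈ (P i).carrier) (h : E → ℝ≥0∞) :
    ∑' e, h e ≤ ∑ i, ∑' e : (P i).carrier, h e := by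
  have hU : (⋃ i, (P i).carrier) = Set.univ := Set.eq_univ_of_forall fun e =>
    Set.mem_iUnion.2 (hP e)
  have := ENNReal.tsum_iUnion_le h fun i => (P i).carrier
  rwa [hU, tsum_univ] at this

theorem H10.powInt_le_of_enorm_le (hp : 2 < p) (hP : ∀ e, ∃ i, e ∈ (P i).carrier) {s : ℝ≥0∞}
    (hs : s ≠ ⊤) (u : G.H10 𝕜) (h : ∀ i, ∀ x ∈ (P i).dom, ‖(P i).pull u.fn x‖ₑ ≤ s) :
    u.powInt p ≤ Fintype.card ι * (s ^ (p - 2) * u.normSq) := by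
  calc u.powInt p ≤ ∑ i, ∑' e : (P i).carrier, powOn p (G.interval e) (u.fn e) :=
        tsum_le_sum_of_cover hP _
    _ ≤ ∑ _i : ι, s ^ (p - 2) * u.normSq := by
        refine Finset.sum_le_sum fun i _ => ?_
        rw [← (P i).powOn_pull]
        refine (powOn_le_of_enorm_le hp hs (P i).isEdgeInterval.measurableSet (h i)
          ((P i).pullDer u.der)).trans ?_
        exact mul_le_mul_right ((P i).energyOn_pull_le _ _) _
    _ = _ := by rw [Finset.sum_const, Finset.card_univ, nsmul_eq_mul]

/-- The edges of a chain may be arbitrarily short, so the embedding constants of single edges need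
not be bounded. The finitely many parts have lengths bounded below. -/
theorem exists_sup_bound (P : ι → Part 𝕜 G) : ∃ K : ℝ≥0∞, K ≠ ⊤ ∧ ∀ (u : G.H10 𝕜) (i : ι),
    ∀ x ∈ (P i).dom, ‖(P i).pull u.fn x‖ₑ ^ 2 ≤ K * u.normSq := by
  choose ℓ hℓ hroom using fun i => (P i).isEdgeInterval.exists_hasRoom
  refine ⟨∑ i, supConst (ℓ i), ENNReal.sum_ne_top.2 fun i _ => supConst_ne_top (hℓ i),
    fun u i x hx => ?_⟩
  obtain ⟨a, ha, hxa⟩ := hroom i x hx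
  refine (((P i).isH1On_pull u).enorm_sq_le (hℓ i) ha hxa).trans ?_
  gcongr
  · exact Finset.single_le_sum (f := fun i => supConst (ℓ i)) (fun _ _ => zero_le)
      (Finset.mem_univ i)
  · exact (P i).energyOn_pull_le _ _

/-- The sup bound s = (K‖u‖²)^(1/2) inserted into the interpolation inequality gives ∫|u|^p ≤ const
· ‖u‖^p. -/
theorem exists_sobolev_const (hp : 2 < p) (hP : ∀ e, ∃ i, e ∈ (P i).carrier) :
    ∃ C : ℝ≥0∞, C ≠ ⊤ ∧ ∀ u : G.H10 𝕜, u.powInt p ^ (2 / p) ≤ C * u.normSq := by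
  obtain ⟨K, hK, hKu⟩ := exists_sup_bound P
  have hp0 : 0 ≤ 2 / p := by positivity
  refine ⟨(Fintype.card ι * K ^ ((p - 2) / 2)) ^ (2 / p), ?_, fun u => ?_⟩
  · refine ENNReal.rpow_ne_top_of_nonneg hp0 (ENNReal.mul_ne_top (by simp) ?_)
    exact ENNReal.rpow_ne_top_of_nonneg (by linarith) hK
  · have h1 := u.powInt_le_of_enorm_le hp hP (s := (K * u.normSq) ^ (1 / 2 : ℝ))
      (ENNReal.rpow_ne_top_of_nonneg (by norm_num) (ENNReal.mul_ne_top hK u.normSq_ne_top))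
      fun i x hx => by
        have := ENNReal.rpow_le_rpow (hKu u i x hx) (show (0 : ℝ) ≤ 1 / 2 by norm_num)
        rwa [← ENNReal.rpow_natCast, ← ENNReal.rpow_mul, show ((2 : ℕ) : ℝ) * (1 / 2) = 1 by
          norm_num, ENNReal.rpow_one] at this
    have e1 : ((K * u.normSq) ^ (1 / 2 : ℝ)) ^ (p - 2) * u.normSq =
        K ^ ((p - 2) / 2) * u.normSq ^ (p / 2) := by
      rw [← ENNReal.rpow_mul, ENNReal.mul_rpow_of_nonneg _ _ (by linarith), mul_assoc]
      congr 1
      · congr 1; ring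
      · nth_rewrite 2 [← ENNReal.rpow_one u.normSq]
        rw [← ENNReal.rpow_add_of_nonneg _ _ (by linarith) zero_le_one]
        congr 1; ring
    rw [e1] at h1
    refine (ENNReal.rpow_le_rpow h1 hp0).trans (le_of_eq ?_)
    rw [← mul_assoc, ENNReal.mul_rpow_of_nonneg _ _ hp0, ← ENNReal.rpow_mul,
      show p / 2 * (2 / p) = 1 by field_simp, ENNReal.rpow_one]

theorem bestConst_ne_top (hp : 2 < p) (hP : ∀ e, ∃ i, e ∈ (P i).carrier) :
    G.bestConst 𝕜 p ≠ ⊤ := by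
  obtain ⟨C, hC, h⟩ := exists_sobolev_const hp hP
  have hle : G.bestConst 𝕜 p ≤ C := sInf_le (by simpa using h)
  exact (hle.trans_lt hC.lt_top).ne

theorem H10.powInt_rpow_le (hp : 2 < p) (hP : ∀ e, ∃ i, e ∈ (P i).carrier) (u : G.H10 𝕜) :
    u.powInt p ^ (2 / p) ≤ G.bestConst 𝕜 p * u.normSq := by
  obtain ⟨C, -, h⟩ := exists_sobolev_const hp hP
  exact ENNReal.le_sInf_mul ⟨C, h⟩ u.normSq_ne_top fun C hC => hC u

theorem H10.powInt_ne_top (hp : 2 < p) (hP : ∀ e, ∃ i, e ∈ (P i).carrier) (u : G.H10 𝕜) :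
    u.powInt p ≠ ⊤ := by
  intro h
  have := u.powInt_rpow_le hp hP
  rw [h, ENNReal.top_rpow_of_pos (by positivity), top_le_iff] at this
  exact ENNReal.mul_ne_top (bestConst_ne_top hp hP) u.normSq_ne_top this

/-- A function violating the inequality with constant C is a competitor in (min) with quotient at
most 1/C. -/
theorem mul_quotient_le_one (hp : 2 < p) {C : ℝ≥0∞} {u : G.H10 𝕜}
    (h : C * u.normSq < u.powInt p ^ (2 / p)) : u.powInt p ≠ 0 ∧ C * u.quotient p ≤ 1 := by
  refine ⟨fun h0 => ?_, ?_⟩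
  · rw [h0, ENNReal.zero_rpow_of_pos (by positivity)] at h
    exact not_lt_zero h
  · rw [H10.quotient, ← mul_div_assoc]
    exact (ENNReal.div_le_div_right h.le _).trans ENNReal.div_self_le_one

theorem infQuotient_eq (hp : 2 < p) (hP : ∀ e, ∃ i, e ∈ (P i).carrier) :
    G.infQuotient 𝕜 p = (G.bestConst 𝕜 p)⁻¹ := by
  apply le_antisymm
  · rw [ENNReal.le_inv_iff_le_inv]
    refine le_of_forall_lt fun C hC => ?_
    obtain ⟨C', hCC', hC'⟩ := exists_between hC
    refine hCC'.trans_le ?_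
    have hnot := notMem_of_lt_csInf hC' (OrderBot.bddBelow _)
    simp only [Set.mem_ofPred_eq, not_forall, not_le] at hnot
    obtain ⟨u, hu⟩ := hnot
    obtain ⟨h0, h1⟩ := mul_quotient_le_one hp hu
    rw [ENNReal.le_inv_iff_mul_le]
    exact (mul_le_mul_right (iInf₂_le u h0) _).trans h1
  · refine le_iInf₂ fun u hu => ?_
    have h1 := u.powInt_rpow_le hp hP
    have hp0 : 0 < 2 / p := by positivity
    rw [H10.quotient, ENNReal.le_div_iff_mul_le
      (.inl (by simpa [ENNReal.rpow_eq_zero_iff, hp0, hp0.not_gt] using hu))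
      (.inl (ENNReal.rpow_ne_top_of_nonneg hp0.le (u.powInt_ne_top hp hP)))]
    calc (G.bestConst 𝕜 p)⁻¹ * u.powInt p ^ (2 / p)
        ≤ (G.bestConst 𝕜 p)⁻¹ * (G.bestConst 𝕜 p * u.normSq) := mul_le_mul_right h1 _
      _ = ((G.bestConst 𝕜 p)⁻¹ * G.bestConst 𝕜 p) * u.normSq := (mul_assoc _ _ _).symm
      _ ≤ 1 * u.normSq := mul_le_mul_left (ENNReal.inv_mul_le_one _) _
      _ = _ := one_mul _

theorem H10.quotient_eq_normSq {u : G.H10 𝕜} (h : u.powInt p = 1) : u.quotient p = u.normSq := by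
  rw [H10.quotient, h, ENNReal.one_rpow, div_one]

/-! ### Tightness of minimising sequences. -/

/-- The energy of the part of a function beyond the point `t` of a ray is controlled by the gap
between the best constants. -/
theorem Part.IsRay.exists_line_part {R : Part 𝕜 G} (hR : R.IsRay) (hp : 2 < p) {C D δ : ℝ≥0∞}
    (hC : ∀ v : G.H10 𝕜, v.powInt p ^ (2 / p) ≤ C * v.normSq)
    (hD : ∀ f g : ℝ → 𝕜, IsH1On Set.univ f g →
      powOn p Set.univ f ^ (2 / p) ≤ D * energyOn Set.univ f g)
    (hCD : C = D + δ) {u : G.H10 𝕜} (hu : u.powInt p = 1) {t : ℝ} (ht : 0 ≤ t) :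
    ∃ w W : ℝ → 𝕜, IsH1On Set.univ w W ∧ (∀ x, t ≤ x → w x = R.pull u.fn x) ∧
      1 + δ * energyOn Set.univ w W ≤ C * (u.normSq + 4 * ‖R.pull u.fn t‖ₑ ^ 2) := by
  have h : IsH1On (Set.Ici 0) (R.pull u.fn) (R.pullDer u.der) := hR.dom_eq ▸ R.isH1On_pull u
  obtain ⟨w, W, hw, hwt, -, hwE⟩ := (h.mono (Set.Ici_subset_Ici.2 ht)).exists_ramp_up
  obtain ⟨φ, ψ, hφ, hφt, hφE⟩ := (h.mono (J := Set.Icc 0 t) fun x hx => hx.1).exists_ramp_down ht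
  obtain ⟨v, hv, hvR⟩ := hR.exists_extension u φ ψ hφ (hφt 0 ht)
  refine ⟨w, W, hw, hwt, ?_⟩
  set c := ‖R.pull u.fn t‖ₑ ^ 2
  have hEu : u.normSq = energyOn (Set.Icc 0 t) (R.pull u.fn) (R.pullDer u.der) +
      energyOn (Set.Ici t) (R.pull u.fn) (R.pullDer u.der) +
      ∑' e : (R.carrierᶜ : Set E), energyOn (G.interval e) (u.fn e) (u.der e) := by
    rw [H10.normSq, R.energy_eq, hR.dom_eq, energyOn_Ici_split ht]
  have hPu : u.powInt p = powOn p (Set.Icc 0 t) (R.pull u.fn) +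
      powOn p (Set.Ici t) (R.pull u.fn) +
      ∑' e : (R.carrierᶜ : Set E), powOn p (G.interval e) (u.fn e) := by
    rw [R.powInt_eq, hR.dom_eq, powOn_Ici_split ht]
  have hEv : v.normSq = energyOn (Set.Ici 0) φ ψ +
      ∑' e : (R.carrierᶜ : Set E), energyOn (G.interval e) (u.fn e) (u.der e) := by
    rw [H10.normSq, R.energy_eq, hR.dom_eq]
    congr 1
    · exact energyOn_congr measurableSet_Ici (fun x hx => (hvR x hx).1)
        (.of_forall fun x hx => (hvR x hx).2)
    · exact tsum_congr fun e => by rw [(hv e.1 e.2).1, (hv e.1 e.2).2]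
  have hPv : powOn p (Set.Icc 0 t) (R.pull u.fn) +
      ∑' e : (R.carrierᶜ : Set E), powOn p (G.interval e) (u.fn e) ≤ v.powInt p := by
    rw [R.powInt_eq, hR.dom_eq]
    gcongr ?_ + ?_
    · refine le_trans (le_of_eq ?_) (powOn_mono (J := Set.Icc 0 t) (fun x hx => hx.1) _ _)
      exact powOn_congr measurableSet_Icc fun x hx => by rw [(hvR x hx.1).1, hφt x hx.2]
    · exact (tsum_congr fun e => by rw [(hv e.1 e.2).1]).le
  have hPw : powOn p (Set.Ici t) (R.pull u.fn) ≤ powOn p Set.univ w := by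
    refine le_trans (le_of_eq ?_) (powOn_mono (Set.subset_univ (Set.Ici t)) _ _)
    exact powOn_congr measurableSet_Ici fun x hx => (hwt x hx).symm
  have hp0 : 0 ≤ 2 / p := by positivity
  have hp1 : 2 / p ≤ 1 := by rw [div_le_one (by linarith)]; linarith
  -- The two cut-offs together carry all of ∫|u|^p, and s ↦ s^(2/p) is subadditive because 2/p ≤ 1.
  have hone : 1 ≤ C * v.normSq + D * energyOn Set.univ w W := by
    calc (1 : ℝ≥0∞) = u.powInt p ^ (2 / p) := by rw [hu, ENNReal.one_rpow]
      _ ≤ (v.powInt p + powOn p Set.univ w) ^ (2 / p) := by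
          refine ENNReal.rpow_le_rpow ?_ hp0
          rw [hPu, add_right_comm]
          exact add_le_add hPv hPw
      _ ≤ v.powInt p ^ (2 / p) + powOn p Set.univ w ^ (2 / p) :=
          ENNReal.rpow_add_le_add_rpow _ _ hp0 hp1
      _ ≤ _ := add_le_add (hC v) (hD w W hw)
  calc 1 + δ * energyOn Set.univ w W
      ≤ C * v.normSq + D * energyOn Set.univ w W + δ * energyOn Set.univ w W := by gcongr
    _ = C * (v.normSq + energyOn Set.univ w W) := by
        rw [add_assoc, ← add_mul, ← hCD, mul_add]
    -- Each of the two ramps costs 2c.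
    _ ≤ C * (u.normSq + 4 * c) := by
        refine mul_le_mul_right ?_ C
        rw [hEv, hEu]
        refine (add_le_add (add_le_add_left hφE _) hwE).trans (le_of_eq ?_)
        ring

/-- Minimising sequences do not escape along a ray. -/
theorem Part.IsRay.tight {R : Part 𝕜 G} (hR : R.IsRay) (hp : 2 < p) {C D δ : ℝ≥0∞}
    (hC : ∀ v : G.H10 𝕜, v.powInt p ^ (2 / p) ≤ C * v.normSq)
    (hD : ∀ f g : ℝ → 𝕜, IsH1On Set.univ f g →
      powOn p Set.univ f ^ (2 / p) ≤ D * energyOn Set.univ f g)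
    (hCD : C = D + δ) (hCt : C ≠ ⊤) (hδ : δ ≠ 0) {u : ℕ → G.H10 𝕜} (hu : ∀ n, (u n).powInt p = 1)
    (hlim : Tendsto (fun n => (u n).normSq) atTop (𝓝 C⁻¹)) {ε : ℝ≥0∞} (hε : ε ≠ 0) :
    ∃ T : ℝ, ∃ n₀, ∀ n ≥ n₀, ∀ x, T ≤ x → ‖R.pull (u n).fn x‖ₑ ^ 2 ≤ ε := by
  wlog hεt : ε ≠ ⊤ generalizing ε
  · obtain ⟨T, n₀, h⟩ := this one_ne_zero ENNReal.one_ne_top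
    refine ⟨T, n₀, fun n hn x hx => (h n hn x hx).trans ?_⟩
    rw [not_not.1 hεt]; exact le_top
  set K := supConst 1
  have hKt : K ≠ ⊤ := supConst_ne_top one_pos
  have hK0 : K ≠ 0 := by simp [K, supConst]
  have hδt : δ ≠ ⊤ := by rintro rfl; exact hCt (by simp [hCD])
  have hC0 : C ≠ 0 := by rintro rfl; exact hδ (by simpa using (add_eq_zero.1 hCD.symm).2)
  -- Read backwards: δ·E ≤ η gives K·E ≤ ε for the energy E of w, and K·E bounds its sup squared.
  -- The excess η over 1 is shared equally by the deviation of `normSq` from C⁻¹ and by the ramps,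
  -- so each may use ζ, where 2Cζ = η.
  set η := δ * ε / K
  have hη0 : η ≠ 0 := (ENNReal.div_pos (mul_ne_zero hδ hε) hKt).ne'
  have hηt : η ≠ ⊤ := ENNReal.div_ne_top (ENNReal.mul_ne_top hδt hεt) hK0
  set ζ := η / (2 * C)
  have hζ0 : ζ ≠ 0 := (ENNReal.div_pos hη0 (ENNReal.mul_ne_top (by simp) hCt)).ne'
  have hζt : ζ ≠ ⊤ := ENNReal.div_ne_top hηt (mul_ne_zero two_ne_zero hC0)
  set M := C⁻¹ + ζ
  have hMt : M ≠ ⊤ := ENNReal.add_ne_top.2 ⟨ENNReal.inv_ne_top.2 hC0, hζt⟩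
  have hev : ∀ᶠ n in atTop, (u n).normSq ≤ M :=
    (hlim.eventually (gt_mem_nhds (ENNReal.lt_add_right (ENNReal.inv_ne_top.2 hC0) hζ0))).mono
      fun n hn => hn.le
  obtain ⟨n₀, hn₀⟩ := eventually_atTop.1 hev
  -- On an interval of length N some value satisfies |u(t)|² ≤ M/N, and 4M/N ≤ ζ.
  set N : ℝ := (4 * M / ζ).toReal + 1
  have hN : 0 < N := by positivity
  have hNM : 4 * (M / ENNReal.ofReal N) ≤ ζ := by
    have h1 : 4 * M / ζ ≤ ENNReal.ofReal N := by
      rw [← ENNReal.ofReal_toReal (ENNReal.div_ne_top (ENNReal.mul_ne_top (by simp) hMt) hζ0)]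
      exact ENNReal.ofReal_le_ofReal (by simp [N])
    rw [← mul_div_assoc]
    rw [ENNReal.div_le_iff (by simpa using hN) (by simp)]
    rwa [ENNReal.div_le_iff hζ0 hζt, mul_comm (ENNReal.ofReal N)] at h1
  refine ⟨N, n₀, fun n hn x hx => ?_⟩
  have h : IsH1On (Set.Ici 0) (R.pull (u n).fn) (R.pullDer (u n).der) :=
    hR.dom_eq ▸ R.isH1On_pull (u n)
  obtain ⟨t, ht, htu⟩ := h.exists_enorm_sq_le (a := 0) hN fun x hx => hx.1
  rw [zero_add] at ht
  obtain ⟨w, W, hw, hwt, hwE⟩ := hR.exists_line_part hp hC hD hCD (hu n) ht.1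
  have hE : energyOn (Set.Ici 0) (R.pull (u n).fn) (R.pullDer (u n).der) ≤ M := by
    rw [← hR.dom_eq]; exact (R.energyOn_pull_le _ _).trans (hn₀ n hn)
  have h4 : 4 * ‖R.pull (u n).fn t‖ₑ ^ 2 ≤ ζ :=
    (mul_le_mul_right (htu.trans (ENNReal.div_le_div_right hE _)) _).trans hNM
  have h5 : 1 + δ * energyOn Set.univ w W ≤ 1 + η := by
    refine hwE.trans ((mul_le_mul_right (add_le_add (hn₀ n hn) h4) C).trans (le_of_eq ?_))
    have : C * (ζ + ζ) = η := by
      rw [← two_mul, ← mul_assoc, mul_comm C 2,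
        ENNReal.mul_div_cancel (mul_ne_zero two_ne_zero hC0) (ENNReal.mul_ne_top (by simp) hCt)]
    rw [add_assoc, mul_add, ENNReal.mul_inv_cancel hC0 hCt, this]
  have h6 : δ * energyOn Set.univ w W ≤ η := (ENNReal.add_le_add_iff_left ENNReal.one_ne_top).1 h5
  have h7 : K * energyOn Set.univ w W ≤ ε := by
    have h8 : δ * (K * energyOn Set.univ w W) ≤ δ * ε := by
      calc δ * (K * energyOn Set.univ w W) = K * (δ * energyOn Set.univ w W) := by ring
        _ ≤ K * η := mul_le_mul_right h6 _
        _ = δ * ε := ENNReal.mul_div_cancel hK0 hKt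
    exact (ENNReal.mul_le_mul_iff_right hδ hδt).1 h8
  rw [← hwt x (ht.2.trans hx)]
  exact (hw.enorm_sq_le (a := x) one_pos (Set.subset_univ _) (by simp)).trans h7

end MetricGraph

/-! ### From tightness to Cauchy sequences in L^p and in H¹₀(G). -/

theorem ENNReal.le_rpow_half_of_sq_le {a b : ℝ≥0∞} (h : a ^ 2 ≤ b) : a ≤ b ^ (1 / 2 : ℝ) := by
  have := ENNReal.rpow_le_rpow h (show (0 : ℝ) ≤ 1 / 2 by norm_num)
  rwa [← ENNReal.rpow_natCast, ← ENNReal.rpow_mul, show ((2 : ℕ) : ℝ) * (1 / 2) = 1 by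
    norm_num, ENNReal.rpow_one] at this

namespace MetricGraph

variable {V E : Type*} {G : MetricGraph V E} {𝕜 : Type*} [RCLike 𝕜] {p : ℝ}
  {ι : Type*} [Fintype ι] {P : ι → Part 𝕜 G}

/-- Tychonoff in place of a diagonal argument: the values at all rational points of all parts lie in
a countable product of closed balls, which is compact and first countable. -/
theorem exists_subseq_cauchySeq_rat (P : ι → Part 𝕜 G) {u : ℕ → G.H10 𝕜} {M : ℝ≥0∞} (hM : M ≠ ⊤)
    (hu : ∀ᶠ n in atTop, (u n).normSq ≤ M) : ∃ φ : ℕ → ℕ, StrictMono φ ∧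
      ∀ (i : ι) (q : ℚ), (q : ℝ) ∈ (P i).dom →
        CauchySeq fun n => (P i).pull (u (φ n)).fn q := by
  classical
  obtain ⟨K, hK, hKu⟩ := exists_sup_bound P
  set B : ℝ≥0∞ := (K * M) ^ (1 / 2 : ℝ)
  have hB : B ≠ ⊤ := ENNReal.rpow_ne_top_of_nonneg (by norm_num) (ENNReal.mul_ne_top hK hM)
  let ev : ℕ → ι × ℚ → 𝕜 := fun n z =>
    if (z.2 : ℝ) ∈ (P z.1).dom then (P z.1).pull (u n).fn z.2 else 0
  have hc : IsCompact (Set.univ.pi fun _ : ι × ℚ => Metric.closedBall (0 : 𝕜) B.toReal) :=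
    isCompact_univ_pi fun _ => isCompact_closedBall _ _
  have hmem : ∀ᶠ n in atTop,
      ev n ∈ Set.univ.pi fun _ : ι × ℚ => Metric.closedBall (0 : 𝕜) B.toReal := by
    filter_upwards [hu] with n hn z _
    rw [mem_closedBall_zero_iff]
    by_cases hz : (z.2 : ℝ) ∈ (P z.1).dom
    · simp only [ev, if_pos hz]
      rw [← toReal_enorm]
      refine ENNReal.toReal_mono hB (ENNReal.le_rpow_half_of_sq_le ?_)
      exact (hKu (u n) z.1 _ hz).trans (mul_le_mul_right hn _)
    · simp [ev, if_neg hz]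
  obtain ⟨a, -, φ, hφ, hlim⟩ := hc.tendsto_subseq' hmem.frequently
  refine ⟨φ, hφ, fun i q hq => ?_⟩
  have := (tendsto_pi_nhds.1 hlim (i, q)).cauchySeq
  simpa only [ev, Function.comp_apply, if_pos hq] using this

/-- Arzelà–Ascoli on a possibly infinite interval. Beyond T both functions are small; before T every
point is close to one of finitely many rational grid points, and equicontinuity does the rest. -/
theorem Part.uniformCauchy (R : Part 𝕜 G) {u : ℕ → G.H10 𝕜} {M : ℝ≥0∞} (hM : M ≠ ⊤)
    (hu : ∀ n, (u n).normSq ≤ M)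
    (hrat : ∀ q : ℚ, (q : ℝ) ∈ R.dom → CauchySeq fun n => R.pull (u n).fn q)
    (htail : ∀ ε : ℝ≥0∞, ε ≠ 0 → ∃ T : ℝ, ∃ n₀, ∀ n ≥ n₀, ∀ x ∈ R.dom, T ≤ x →
      ‖R.pull (u n).fn x‖ₑ ^ 2 ≤ ε) {ε : ℝ≥0∞} (hε : ε ≠ 0) :
    ∃ n₀, ∀ n ≥ n₀, ∀ m ≥ n₀, ∀ x ∈ R.dom,
      ‖R.pull (u n).fn x - R.pull (u m).fn x‖ₑ ≤ ε := by
  have hε2 : ε / 2 ≠ 0 := (ENNReal.half_pos hε).ne'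
  have hε3 : ε / 3 ≠ 0 := (ENNReal.div_pos hε (by simp)).ne'
  obtain ⟨T, n₁, hT⟩ := htail ((ε / 2) ^ 2) (pow_ne_zero 2 hε2)
  -- The mesh 1/(k + 1) is so fine that a function of energy at most M varies by at most ε/3 over
  -- one cell.
  obtain ⟨k, hk⟩ : ∃ k : ℕ, ENNReal.ofReal (1 / ((k : ℝ) + 1)) * M ≤ (ε / 3) ^ 2 := by
    have h1 : Tendsto (fun k : ℕ => ENNReal.ofReal (1 / ((k : ℝ) + 1)) * M) atTop (𝓝 0) := by
      have := ENNReal.tendsto_ofReal tendsto_one_div_add_atTop_nhds_zero_nat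
      rw [ENNReal.ofReal_zero] at this
      simpa using ENNReal.Tendsto.mul_const this (.inr hM)
    exact ((h1.eventually (gt_mem_nhds
      (pos_iff_ne_zero.2 (pow_ne_zero 2 hε3)))).exists).imp fun k hk => hk.le
  have hgrid : ∀ j : ℕ, ∃ N, ((((j : ℚ) / ((k : ℚ) + 1) : ℚ) : ℝ) ∈ R.dom → ∀ n ≥ N, ∀ m ≥ N,
      ‖R.pull (u n).fn ((j : ℚ) / ((k : ℚ) + 1) : ℚ) -
        R.pull (u m).fn ((j : ℚ) / ((k : ℚ) + 1) : ℚ)‖ₑ ≤ ε / 3) := by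
    intro j
    by_cases hj : (((j : ℚ) / ((k : ℚ) + 1) : ℚ) : ℝ) ∈ R.dom
    · obtain ⟨N, hN⟩ := EMetric.cauchySeq_iff.1 (hrat _ hj) (ε / 3) (pos_iff_ne_zero.2 hε3)
      refine ⟨N, fun _ n hn m hm => ?_⟩
      rw [← edist_eq_enorm_sub]
      exact (hN n hn m hm).le
    · exact ⟨0, fun h => absurd h hj⟩
  choose N hN using hgrid
  refine ⟨max n₁ ((Finset.range (⌊T * (k + 1)⌋₊ + 1)).sup N), fun n hn m hm x hx => ?_⟩
  rcases le_or_gt T x with hTx | hTx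
  · have h1 : ∀ n ≥ n₁, ‖R.pull (u n).fn x‖ₑ ≤ ε / 2 := fun n hn =>
      (ENNReal.pow_right_strictMono two_ne_zero).le_iff_le.1 (hT n hn x hx hTx)
    refine (enorm_sub_le).trans ?_
    rw [← ENNReal.add_halves ε]
    exact add_le_add (h1 n (le_of_max_le_left hn)) (h1 m (le_of_max_le_left hm))
  · have hx0 := R.isEdgeInterval.nonneg hx
    have hk0 : (0 : ℝ) < (k : ℝ) + 1 := by positivity
    set j := ⌊x * (k + 1)⌋₊
    set q : ℚ := (j : ℚ) / ((k : ℚ) + 1)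
    have hqe : (q : ℝ) = (j : ℝ) / ((k : ℝ) + 1) := by simp [q]
    have hqx : (q : ℝ) ≤ x := by
      rw [hqe, div_le_iff₀ hk0]
      exact Nat.floor_le (by positivity)
    have hxq : x - q ≤ 1 / ((k : ℝ) + 1) := by
      rw [hqe, sub_le_iff_le_add, ← add_div, le_div_iff₀ hk0, add_comm (1 : ℝ)]
      exact (Nat.lt_floor_add_one (x * ((k : ℝ) + 1))).le
    -- Rounding down keeps the grid point in the domain, since it stays between 0 and x.
    have hqd : (q : ℝ) ∈ R.dom :=
      R.isEdgeInterval.mem_of_le hx (by rw [hqe]; positivity) hqx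
    have hj : j ∈ Finset.range (⌊T * (k + 1)⌋₊ + 1) := by
      rw [Finset.mem_range, Nat.lt_succ_iff]
      exact Nat.floor_le_floor (by gcongr)
    have hNj : N j ≤ (Finset.range (⌊T * (k + 1)⌋₊ + 1)).sup N := Finset.le_sup hj
    have hosc : ∀ n, ‖R.pull (u n).fn x - R.pull (u n).fn q‖ₑ ≤ ε / 3 := by
      intro n
      refine (ENNReal.pow_right_strictMono two_ne_zero).le_iff_le.1 ?_
      refine ((R.isH1On_pull (u n)).enorm_sub_sq_le hqd hx).trans (le_trans ?_ hk)
      gcongr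
      · rwa [abs_of_nonneg (by linarith)]
      · exact (R.energyOn_pull_le _ _).trans (hu n)
    have hq := hN j hqd n (hNj.trans (le_of_max_le_right hn)) m
      (hNj.trans (le_of_max_le_right hm))
    have e : R.pull (u n).fn x - R.pull (u m).fn x =
        (R.pull (u n).fn x - R.pull (u n).fn q) + (R.pull (u n).fn q - R.pull (u m).fn q) +
        (R.pull (u m).fn q - R.pull (u m).fn x) := by ring
    rw [e, ← ENNReal.add_thirds ε]
    refine (enorm_add_le _ _).trans (add_le_add ((enorm_add_le _ _).trans
      (add_le_add (hosc n) hq)) ?_)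
    rw [enorm_sub_rev]
    exact hosc m

theorem enorm_parallelogram (a b : 𝕜) :
    2 * (‖2⁻¹ * a + 2⁻¹ * b‖ₑ ^ 2 + ‖2⁻¹ * a + -2⁻¹ * b‖ₑ ^ 2) = ‖a‖ₑ ^ 2 + ‖b‖ₑ ^ 2 := by
  have h := parallelogram_law_with_norm ℝ (2⁻¹ * a) (2⁻¹ * b)
  have e : (2⁻¹ * a - 2⁻¹ * b : 𝕜) = 2⁻¹ * a + -2⁻¹ * b := by ring
  rw [e] at h
  simp only [norm_mul, norm_inv, RCLike.norm_ofNat] at h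
  have h' : 2 * (‖2⁻¹ * a + 2⁻¹ * b‖ ^ 2 + ‖2⁻¹ * a + -2⁻¹ * b‖ ^ 2) = ‖a‖ ^ 2 + ‖b‖ ^ 2 := by
    nlinarith
  have h'' := congrArg ENNReal.ofReal h'
  rw [ENNReal.ofReal_mul zero_le_two, ENNReal.ofReal_add (by positivity) (by positivity),
    ENNReal.ofReal_add (by positivity) (by positivity)] at h''
  simpa [ENNReal.ofReal_pow, ofReal_norm] using h''

namespace H10

/-- An inequality suffices, so superadditivity of the integral can be used, with no measurability of
the combinations. -/
theorem parallelogram_le (u w : G.H10 𝕜) :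
    2 * ((comb 2⁻¹ 2⁻¹ u w).normSq + (comb 2⁻¹ (-2⁻¹) u w).normSq) ≤ u.normSq + w.normSq := by
  unfold normSq energy
  rw [← ENNReal.tsum_add, ← ENNReal.tsum_add, ← ENNReal.tsum_mul_left]
  refine ENNReal.tsum_le_tsum fun e => ?_
  unfold energyOn
  rw [← lintegral_add_left' (u.isH1On e).aemeasurable_energy]
  refine (mul_le_mul_right (le_lintegral_add _ _) _).trans ?_
  rw [← lintegral_const_mul' _ _ (by simp)]
  refine lintegral_mono fun x => le_of_eq ?_
  have h1 := enorm_parallelogram (u.der e x) (w.der e x)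
  have h2 := enorm_parallelogram (u.fn e x) (w.fn e x)
  simp only [comb]
  rw [add_add_add_comm (‖u.der e x‖ₑ ^ 2), ← h1, ← h2]
  ring

theorem powInt_le_weighted (hp : 2 < p) {θ τ : ℝ≥0∞} (hθτ : θ + τ = 1) (hθ : θ ≠ 0) (hτ : τ ≠ 0)
    {u a b : G.H10 𝕜} (h : ∀ e x, ‖u.fn e x‖ₑ ≤ ‖a.fn e x‖ₑ + ‖b.fn e x‖ₑ) :
    u.powInt p ≤ θ ^ (1 - p) * a.powInt p + τ ^ (1 - p) * b.powInt p := by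
  have hθt : θ ^ (1 - p) ≠ ⊤ := ENNReal.rpow_ne_top_of_ne_zero hθ (by rintro rfl; simp at hθτ)
  have hτt : τ ^ (1 - p) ≠ ⊤ := ENNReal.rpow_ne_top_of_ne_zero hτ (by rintro rfl; simp at hθτ)
  unfold powInt
  rw [← ENNReal.tsum_mul_left, ← ENNReal.tsum_mul_left, ← ENNReal.tsum_add]
  refine ENNReal.tsum_le_tsum fun e => ?_
  unfold powOn
  rw [← lintegral_const_mul' _ _ hθt, ← lintegral_const_mul' _ _ hτt,
    ← lintegral_add_left' ((((a.isH1On e).memLp_fn.1.enorm).pow_const p).const_mul _)]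
  refine lintegral_mono fun x => ?_
  exact (ENNReal.rpow_le_rpow (h e x) (by linarith)).trans
    (ENNReal.add_rpow_le_weighted hθτ hθ hτ (by linarith) _ _)

/-- A substitute for the triangle inequality of the H¹₀ norm in terms of squares:
`add_rpow_le_weighted` with exponent 2, applied pointwise. -/
theorem normSq_le_weighted {θ τ : ℝ≥0∞} (hθτ : θ + τ = 1) (hθ : θ ≠ 0) (hτ : τ ≠ 0)
    (u a : G.H10 𝕜) : u.normSq ≤ θ⁻¹ * a.normSq + τ⁻¹ * a.distSq u := by
  have hθt : θ⁻¹ ≠ ⊤ := ENNReal.inv_ne_top.2 hθ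
  have hτt : τ⁻¹ ≠ ⊤ := ENNReal.inv_ne_top.2 hτ
  unfold normSq distSq energy
  rw [← ENNReal.tsum_mul_left, ← ENNReal.tsum_mul_left, ← ENNReal.tsum_add]
  refine ENNReal.tsum_le_tsum fun e => ?_
  unfold energyOn
  rw [← lintegral_const_mul' _ _ hθt, ← lintegral_const_mul' _ _ hτt,
    ← lintegral_add_left' ((a.isH1On e).aemeasurable_energy.const_mul _)]
  refine lintegral_mono fun x => ?_
  have key : ∀ y z : 𝕜, ‖y‖ₑ ^ 2 ≤ θ⁻¹ * ‖z‖ₑ ^ 2 + τ⁻¹ * ‖z - y‖ₑ ^ 2 := by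
    intro y z
    have h := ENNReal.add_rpow_le_weighted hθτ hθ hτ one_le_two ‖z‖ₑ ‖z - y‖ₑ
    have e : (1 : ℝ) - 2 = -1 := by norm_num
    rw [e, ENNReal.rpow_neg_one, ENNReal.rpow_neg_one, ENNReal.rpow_ofNat, ENNReal.rpow_ofNat,
      ENNReal.rpow_ofNat] at h
    refine le_trans ?_ h
    gcongr
    calc ‖y‖ₑ = ‖z - (z - y)‖ₑ := by rw [sub_sub_cancel]
      _ ≤ _ := enorm_sub_le
  refine (add_le_add (key (u.der e x) (a.der e x)) (key (u.fn e x) (a.fn e x))).trans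
    (le_of_eq ?_)
  simp only [Pi.sub_apply]
  ring

theorem distSq_eq_normSq (u w : G.H10 𝕜) : u.distSq w = (comb 1 (-1) u w).normSq := by
  unfold distSq normSq comb
  congr 1 <;> · funext e x; simp [sub_eq_add_neg]

theorem distSq_eq_four_mul (u w : G.H10 𝕜) :
    u.distSq w = 4 * (comb 2⁻¹ (-2⁻¹) u w).normSq := by
  unfold distSq normSq energy energyOn
  rw [← ENNReal.tsum_mul_left]
  refine tsum_congr fun e => ?_
  rw [← lintegral_const_mul' _ _ (by simp)]
  refine lintegral_congr fun x => ?_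
  have key : ∀ a b : 𝕜, ‖a - b‖ₑ ^ 2 = 4 * ‖2⁻¹ * a + -2⁻¹ * b‖ₑ ^ 2 := by
    intro a b
    have : a - b = 2 * (2⁻¹ * a + -2⁻¹ * b) := by ring
    rw [this, enorm_mul, mul_pow]
    congr 1
    rw [← ofReal_norm, RCLike.norm_ofNat]
    norm_num
  simp only [Pi.sub_apply, key, comb]
  ring

end H10

theorem cauchy_powInt (hp : 2 < p) (hP : ∀ e, ∃ i, e ∈ (P i).carrier) {u : ℕ → G.H10 𝕜}
    {M : ℝ≥0∞} (hM : M ≠ ⊤) (hu : ∀ n, (u n).normSq ≤ M)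
    (huc : ∀ i, ∀ ε : ℝ≥0∞, ε ≠ 0 → ∃ n₀, ∀ n ≥ n₀, ∀ m ≥ n₀, ∀ x ∈ (P i).dom,
      ‖(P i).pull (u n).fn x - (P i).pull (u m).fn x‖ₑ ≤ ε) {ε : ℝ≥0∞} (hε : ε ≠ 0) :
    ∃ n₀, ∀ n ≥ n₀, ∀ m ≥ n₀, (H10.comb 2⁻¹ (-2⁻¹) (u n) (u m)).powInt p ≤ ε := by
  wlog hεt : ε ≠ ⊤ generalizing ε
  · obtain ⟨n₀, h⟩ := this one_ne_zero ENNReal.one_ne_top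
    refine ⟨n₀, fun n hn m hm => (h n hn m hm).trans ?_⟩
    rw [not_not.1 hεt]; exact le_top
  -- The summand 1 only keeps B away from 0, so that one may divide by it.
  set B : ℝ≥0∞ := Fintype.card ι * (2 * M) + 1
  have hBt : B ≠ ⊤ := by simp only [B]; finiteness
  have hB0 : B ≠ 0 := by simp [B]
  set s : ℝ≥0∞ := (ε / B) ^ (1 / (p - 2))
  have hp2 : 0 < p - 2 := by linarith
  have hs : s ^ (p - 2) = ε / B := by
    rw [← ENNReal.rpow_mul, one_div_mul_cancel hp2.ne', ENNReal.rpow_one]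
  have hst : s ≠ ⊤ := ENNReal.rpow_ne_top_of_nonneg (by positivity) (ENNReal.div_ne_top hεt hB0)
  have hs0 : s ≠ 0 := by
    intro h0
    rw [h0, ENNReal.zero_rpow_of_pos hp2] at hs
    exact (ENNReal.div_pos hε hBt).ne hs
  choose n₀ hn₀ using fun i => huc i s hs0
  refine ⟨Finset.univ.sup n₀, fun n hn m hm => ?_⟩
  have hle : ∀ i, n₀ i ≤ Finset.univ.sup n₀ := fun i => Finset.le_sup (Finset.mem_univ i)
  have h1 := (H10.comb 2⁻¹ (-2⁻¹) (u n) (u m)).powInt_le_of_enorm_le hp hP hst fun i x hx => by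
    refine le_trans ?_ (hn₀ i n ((hle i).trans hn) m ((hle i).trans hm) x hx)
    have e : (P i).pull (H10.comb 2⁻¹ (-2⁻¹) (u n) (u m)).fn x =
        2⁻¹ * ((P i).pull (u n).fn x - (P i).pull (u m).fn x) := by
      simp only [Part.pull, H10.comb]; ring
    rw [e, enorm_mul]
    refine mul_le_of_le_one_left' ?_
    rw [← ofReal_norm, norm_inv, RCLike.norm_ofNat]
    norm_num
  refine h1.trans ?_
  have hE : (H10.comb 2⁻¹ (-2⁻¹) (u n) (u m)).normSq ≤ 2 * M := by
    have := H10.parallelogram_le (u n) (u m)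
    calc _ ≤ 2 * ((H10.comb 2⁻¹ 2⁻¹ (u n) (u m)).normSq +
          (H10.comb 2⁻¹ (-2⁻¹) (u n) (u m)).normSq) := by
            rw [two_mul]
            exact le_add_self.trans le_add_self
      _ ≤ _ := this
      _ ≤ M + M := add_le_add (hu n) (hu m)
      _ = 2 * M := (two_mul M).symm
  calc (Fintype.card ι : ℝ≥0∞) * (s ^ (p - 2) * (H10.comb 2⁻¹ (-2⁻¹) (u n) (u m)).normSq)
      ≤ Fintype.card ι * (ε / B * (2 * M)) := by rw [hs]; gcongr
    _ = (Fintype.card ι * (2 * M)) * (ε / B) := by ring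
    _ ≤ B * (ε / B) := by gcongr; exact le_self_add
    _ = ε := ENNReal.mul_div_cancel hB0 hBt

/-- A minimising sequence that is a Cauchy sequence in `L^p` is a Cauchy sequence in `H¹₀`. -/
theorem cauchy_distSq (hp : 2 < p) {C : ℝ≥0∞} (hCt : C ≠ ⊤) (hC0 : C ≠ 0)
    (hC : ∀ v : G.H10 𝕜, v.powInt p ^ (2 / p) ≤ C * v.normSq) {u : ℕ → G.H10 𝕜}
    (hu : ∀ n, (u n).powInt p = 1) (hlim : Tendsto (fun n => (u n).normSq) atTop (𝓝 C⁻¹))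
    (hc : ∀ ε : ℝ≥0∞, ε ≠ 0 → ∃ n₀, ∀ n ≥ n₀, ∀ m ≥ n₀,
      (H10.comb 2⁻¹ (-2⁻¹) (u n) (u m)).powInt p ≤ ε) {ε : ℝ≥0∞} (hε : ε ≠ 0) :
    ∃ n₀, ∀ n ≥ n₀, ∀ m ≥ n₀, (u n).distSq (u m) ≤ ε := by
  -- With d the half-difference, the estimates below end in C‖d‖² ≤ 3τ, and the squared distance is
  -- 4‖d‖²; hence the 12.
  set τ : ℝ≥0∞ := min (ε * C / 12) 2⁻¹
  have hτ0 : τ ≠ 0 := by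
    refine (lt_min (ENNReal.div_pos (mul_ne_zero hε hC0) (by simp)) (by simp)).ne'
  have hτh : τ ≤ 2⁻¹ := min_le_right _ _
  have hτ1 : τ < 1 := hτh.trans_lt (by simp)
  have hτt : τ ≠ ⊤ := (hτ1.trans ENNReal.one_lt_top).ne
  set θ : ℝ≥0∞ := 1 - τ
  have hθτ : θ + τ = 1 := tsub_add_cancel_of_le hτ1.le
  have hθ0 : θ ≠ 0 := (tsub_pos_of_lt hτ1).ne'
  have hθ1 : θ ≤ 1 := tsub_le_self
  have hθt : θ ≠ ⊤ := (hθ1.trans_lt ENNReal.one_lt_top).ne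
  have hτr0 : τ ^ (1 - p) ≠ 0 := by
    simp [ENNReal.rpow_eq_zero_iff, hτ0, hτt]
  have hτrt : τ ^ (1 - p) ≠ ⊤ := ENNReal.rpow_ne_top_of_ne_zero hτ0 hτt
  obtain ⟨n₁, hn₁⟩ := hc (τ / τ ^ (1 - p)) (ENNReal.div_pos hτ0 hτrt).ne'
  have hCi : C⁻¹ ≠ ⊤ := ENNReal.inv_ne_top.2 hC0
  obtain ⟨n₂, hn₂⟩ := eventually_atTop.1 (hlim.eventually (gt_mem_nhds
    (ENNReal.lt_add_right hCi (ENNReal.div_pos hτ0 hCt).ne')))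
  refine ⟨max n₁ n₂, fun n hn m hm => ?_⟩
  set S := H10.comb 2⁻¹ 2⁻¹ (u n) (u m)
  set d := H10.comb 2⁻¹ (-2⁻¹) (u n) (u m)
  have hd : τ ^ (1 - p) * d.powInt p ≤ τ := by
    refine (mul_le_mul_right (hn₁ n (le_of_max_le_left hn) m (le_of_max_le_left hm)) _).trans ?_
    rw [ENNReal.mul_div_cancel hτr0 hτrt]
  have hE : ∀ k ≥ n₂, C * (u k).normSq ≤ 1 + τ := by
    intro k hk
    refine (mul_le_mul_right (hn₂ k hk).le C).trans (le_of_eq ?_)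
    rw [mul_add, ENNReal.mul_inv_cancel hC0 hCt, ENNReal.mul_div_cancel hC0 hCt]
  -- As u_n = S + d and d is small in L^p, the midpoint S keeps ∫|S|^p ≥ θ^p; the Sobolev inequality
  -- then forces C‖S‖² ≥ θ² ≥ 1 - 2τ.
  have h1 : 1 ≤ θ ^ (1 - p) * S.powInt p + τ := by
    rw [← hu n]
    refine (H10.powInt_le_weighted hp hθτ hθ0 hτ0 (a := S) (b := d) fun e x => ?_).trans
      (add_le_add_right hd _)
    have e1 : (u n).fn e x = S.fn e x + d.fn e x := by
      simp only [S, d, H10.comb]; ring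
    rw [e1]
    exact enorm_add_le _ _
  have h2 : θ ≤ θ ^ (1 - p) * S.powInt p := by
    rw [← hθτ] at h1
    exact (ENNReal.add_le_add_iff_right hτt).1 h1
  have h3 : θ ^ p ≤ S.powInt p := by
    have h4 := mul_le_mul_right h2 (θ ^ (p - 1))
    rw [← mul_assoc, ← ENNReal.rpow_add _ _ hθ0 hθt] at h4
    nth_rewrite 2 [← ENNReal.rpow_one θ] at h4
    rw [← ENNReal.rpow_add _ _ hθ0 hθt] at h4
    simpa using h4
  have h4 : θ ^ 2 ≤ C * S.normSq := by
    refine le_trans (le_of_eq ?_) ((ENNReal.rpow_le_rpow h3 (by positivity)).trans (hC S))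
    rw [← ENNReal.rpow_mul, show p * (2 / p) = 2 by field_simp, ENNReal.rpow_ofNat]
  have h5 : 1 ≤ θ ^ 2 + 2 * τ := by
    calc (1 : ℝ≥0∞) = (θ + τ) ^ 2 := by rw [hθτ, one_pow]
      _ = θ ^ 2 + (θ + (θ + τ)) * τ := by ring
      _ ≤ θ ^ 2 + (1 + 1) * τ := by rw [hθτ]; gcongr
      _ = _ := by rw [one_add_one_eq_two]
  have h6 : 2 * (C * S.normSq + C * d.normSq) ≤ 2 * (1 + τ) := by
    calc 2 * (C * S.normSq + C * d.normSq) = C * (2 * (S.normSq + d.normSq)) := by ring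
      _ ≤ C * ((u n).normSq + (u m).normSq) := mul_le_mul_right (H10.parallelogram_le _ _) C
      _ = C * (u n).normSq + C * (u m).normSq := mul_add _ _ _
      _ ≤ (1 + τ) + (1 + τ) :=
          add_le_add (hE n (le_of_max_le_right hn)) (hE m (le_of_max_le_right hm))
      _ = 2 * (1 + τ) := (two_mul _).symm
  have h7 : C * S.normSq + C * d.normSq ≤ 1 + τ :=
    (ENNReal.mul_le_mul_iff_right two_ne_zero (by simp)).1 h6
  -- The parallelogram law bounds the sum by 1 + τ, and the midpoint already takes at least 1 - 2τ.
  have h8 : C * d.normSq ≤ 3 * τ := by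
    have : 1 + C * d.normSq ≤ 1 + 3 * τ := by
      calc 1 + C * d.normSq ≤ (θ ^ 2 + 2 * τ) + C * d.normSq := by gcongr
        _ ≤ (C * S.normSq + 2 * τ) + C * d.normSq := by gcongr
        _ = (C * S.normSq + C * d.normSq) + 2 * τ := by ring
        _ ≤ (1 + τ) + 2 * τ := by gcongr
        _ = _ := by ring
    exact (ENNReal.add_le_add_iff_left ENNReal.one_ne_top).1 this
  have h9 : C * (u n).distSq (u m) ≤ C * ε := by
    calc C * (u n).distSq (u m) = 4 * (C * d.normSq) := by rw [H10.distSq_eq_four_mul]; ring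
      _ ≤ 4 * (3 * τ) := by gcongr
      _ = 12 * τ := by rw [← mul_assoc]; norm_num
      _ ≤ 12 * (ε * C / 12) := by gcongr; exact min_le_left _ _
      _ = C * ε := by rw [ENNReal.mul_div_cancel (by simp) (by simp), mul_comm]
  exact (ENNReal.mul_le_mul_iff_right hC0 hCt).1 h9

end MetricGraph

/-! ### Completeness of H¹₀(G) and convergence of minimising sequences. -/

namespace MetricGraph

variable {V E : Type*} {G : MetricGraph V E} {𝕜 : Type*} [RCLike 𝕜] {p : ℝ}
  {ι : Type*} [Fintype ι] {P : ι → Part 𝕜 G}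

theorem energyOn_sub_le {I : Set ℝ} {f₁ g₁ f₂ g₂ f₃ g₃ : ℝ → 𝕜}
    (h : IsH1On I (f₁ - f₂) (g₁ - g₂)) :
    energyOn I (f₁ - f₃) (g₁ - g₃) ≤
      2 * energyOn I (f₁ - f₂) (g₁ - g₂) + 2 * energyOn I (f₂ - f₃) (g₂ - g₃) := by
  have h1 := energyOn_comb_le I (1 : 𝕜) 1 (f₁ - f₂) (g₁ - g₂) (f₂ - f₃) (g₂ - g₃) h
  have e : ∀ a b c : ℝ → 𝕜, (fun x => 1 * (a - b) x + 1 * (b - c) x) = a - c := by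
    intro a b c; funext x; simp
  rw [e, e, enorm_one, one_pow, mul_one] at h1
  exact h1

theorem energyOn_le_sub {I : Set ℝ} {f₁ g₁ f₂ g₂ : ℝ → 𝕜} (h : IsH1On I f₁ g₁) :
    energyOn I f₂ g₂ ≤ 2 * energyOn I f₁ g₁ + 2 * energyOn I (f₁ - f₂) (g₁ - g₂) := by
  have h1 := energyOn_comb_le I 1 (-1) f₁ g₁ (f₁ - f₂) (g₁ - g₂) h
  have e : ∀ a b : ℝ → 𝕜, (fun x => 1 * a x + -1 * (a - b) x) = b := by
    intro a b; funext x; simp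
  simpa [e] using h1

/-- Completeness of `H¹₀(G)`. -/
theorem H10.exists_limit {u : ℕ → G.H10 𝕜} (hc : ∀ ε : ℝ≥0∞, ε ≠ 0 → ∃ n₀, ∀ n ≥ n₀, ∀ m ≥ n₀,
    (u n).distSq (u m) ≤ ε) :
    ∃ v : G.H10 𝕜, Tendsto (fun n => (u n).distSq v) atTop (𝓝 0) := by
  have hedge : ∀ e, ∃ F D : ℝ → 𝕜, IsH1On (G.interval e) F D ∧
      (∀ x ∈ G.interval e, Tendsto (fun n => (u n).fn e x) atTop (𝓝 (F x))) ∧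
      Tendsto (fun n => energyOn (G.interval e) ((u n).fn e - F) ((u n).der e - D))
        atTop (𝓝 0) := by
    intro e
    obtain ⟨ℓ, hℓ, hroom⟩ := (G.isEdgeInterval_interval e).exists_hasRoom
    refine exists_isH1On_limit (G.isEdgeInterval_interval e).measurableSet hℓ hroom
      (fun n => (u n).isH1On e) fun ε hε => ?_
    obtain ⟨n₀, hn₀⟩ := hc ε hε.ne'
    refine ⟨n₀, fun n hn m hm => le_trans ?_ (hn₀ n hn m hm)⟩
    exact ENNReal.le_tsum (f := fun e => energyOn (G.interval e)
      (((u n).fn - (u m).fn) e) (((u n).der - (u m).der) e)) e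
  choose F D hFD hlim hE using hedge
  -- A Fatou-type argument: compare with u_m on finitely many edges, let m → ∞ there, then take the
  -- supremum over finite sets of edges. The 2 comes from the squared triangle inequality.
  have hsum : ∀ ε : ℝ≥0∞, ε ≠ 0 → ∃ n₀, ∀ n ≥ n₀,
      G.energy ((u n).fn - F) ((u n).der - D) ≤ 2 * ε := by
    intro ε hε
    obtain ⟨n₀, hn₀⟩ := hc ε hε
    refine ⟨n₀, fun n hn => ?_⟩
    unfold energy
    rw [ENNReal.tsum_eq_iSup_sum]
    refine iSup_le fun s => ?_
    have ht : Tendsto (fun m => 2 * ε + 2 * ∑ e ∈ s, energyOn (G.interval e)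
        ((u m).fn e - F e) ((u m).der e - D e)) atTop (𝓝 (2 * ε)) := by
      have h1 := tendsto_finsetSum s fun e _ => hE e
      have h2 := (ENNReal.Tendsto.const_mul (a := 2) h1 (.inr (by simp))).const_add (2 * ε)
      simpa using h2
    refine ge_of_tendsto ht ?_
    filter_upwards [eventually_ge_atTop n₀] with m hm
    calc ∑ e ∈ s, energyOn (G.interval e) ((u n).fn e - F e) ((u n).der e - D e)
        ≤ ∑ e ∈ s, (2 * energyOn (G.interval e) ((u n).fn e - (u m).fn e)
            ((u n).der e - (u m).der e) + 2 * energyOn (G.interval e)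
            ((u m).fn e - F e) ((u m).der e - D e)) :=
          Finset.sum_le_sum fun e _ => energyOn_sub_le (((u n).isH1On e).sub ((u m).isH1On e))
      _ = 2 * ∑ e ∈ s, energyOn (G.interval e) ((u n).fn e - (u m).fn e)
            ((u n).der e - (u m).der e) + 2 * ∑ e ∈ s, energyOn (G.interval e)
            ((u m).fn e - F e) ((u m).der e - D e) := by
          rw [Finset.sum_add_distrib, Finset.mul_sum, Finset.mul_sum]
      _ ≤ _ := by
          gcongr
          exact (ENNReal.sum_le_tsum (f := fun e => energyOn (G.interval e)
            ((u n).fn e - (u m).fn e) ((u n).der e - (u m).der e)) s).trans (hn₀ n hn m hm)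
  refine ⟨⟨F, D, hFD, fun a b hab => ?_, fun a ha => ?_, ?_⟩, ?_⟩
  · refine tendsto_nhds_unique (hlim _ _ (pos_mem_interval a)) ?_
    simpa only [(u _).continuous_at_vertices a b hab] using hlim _ _ (pos_mem_interval b)
  · refine tendsto_nhds_unique (hlim _ _ (pos_mem_interval a)) ?_
    simp only [(u _).dirichlet a ha, tendsto_const_nhds]
  · obtain ⟨n₀, hn₀⟩ := hsum 1 one_ne_zero
    have h1 : G.energy F D ≤ 2 * (u n₀).normSq +
        2 * G.energy ((u n₀).fn - F) ((u n₀).der - D) := by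
      unfold H10.normSq energy
      rw [← ENNReal.tsum_mul_left, ← ENNReal.tsum_mul_left, ← ENNReal.tsum_add]
      exact ENNReal.tsum_le_tsum fun e => energyOn_le_sub ((u n₀).isH1On e)
    refine h1.trans_lt (ENNReal.add_lt_top.2 ⟨?_, ?_⟩)
    · exact ENNReal.mul_lt_top (by simp) (u n₀).energy_lt_top
    · exact ENNReal.mul_lt_top (by simp) ((hn₀ n₀ le_rfl).trans_lt (by simp))
  · rw [ENNReal.tendsto_atTop_zero]
    intro ε hε
    obtain ⟨n₀, hn₀⟩ := hsum (ε / 2) (ENNReal.half_pos hε.ne').ne'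
    refine ⟨n₀, fun n hn => (hn₀ n hn).trans (le_of_eq ?_)⟩
    exact ENNReal.mul_div_cancel two_ne_zero (by simp)

theorem H10.distSq_comm (u v : G.H10 𝕜) : u.distSq v = v.distSq u := by
  unfold distSq energy energyOn
  simp only [Pi.sub_apply, enorm_sub_rev (u.fn _ _), enorm_sub_rev (u.der _ _)]

theorem IsMinimizingSeq.tendsto_normSq {u : ℕ → G.H10 𝕜} (hu : IsMinimizingSeq p u) :
    Tendsto (fun n => (u n).normSq) atTop (𝓝 (G.infQuotient 𝕜 p)) :=
  hu.2.congr fun n => H10.quotient_eq_normSq (hu.1 n)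

theorem IsMinimizingSeq.comp {u : ℕ → G.H10 𝕜} (hu : IsMinimizingSeq p u) {φ : ℕ → ℕ}
    (hφ : Tendsto φ atTop atTop) : IsMinimizingSeq p fun n => u (φ n) :=
  ⟨fun n => hu.1 (φ n), hu.2.comp hφ⟩

/-- If the best constant of `G` exceeds that of the line, then every minimising sequence has a
convergent subsequence. -/
theorem IsMinimizingSeq.exists_subseq (hp : 2 < p) (hP : ∀ e, ∃ i, e ∈ (P i).carrier)
    (hray : ∀ i, (P i).IsRay ∨ ∃ ℓ > 0, (P i).dom = Set.Icc 0 ℓ)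
    (hCD : bestConstLine 𝕜 p < G.bestConst 𝕜 p) {u : ℕ → G.H10 𝕜} (hu : IsMinimizingSeq p u) :
    ∃ φ : ℕ → ℕ, StrictMono φ ∧ ∃ v : G.H10 𝕜,
      Tendsto (fun n => (u (φ n)).distSq v) atTop (𝓝 0) := by
  have hCt : G.bestConst 𝕜 p ≠ ⊤ := bestConst_ne_top hp hP
  have hC0 : G.bestConst 𝕜 p ≠ 0 := (zero_le.trans_lt hCD).ne'
  have hC := H10.powInt_rpow_le (𝕜 := 𝕜) hp hP
  have hD := fun f g => powOn_rpow_le_bestConstLine (𝕜 := 𝕜) (p := p) (f := f) (g := g) hCD.ne_top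
  have hδ : G.bestConst 𝕜 p - bestConstLine 𝕜 p ≠ 0 := (tsub_pos_of_lt hCD).ne'
  have hsplit : G.bestConst 𝕜 p = bestConstLine 𝕜 p + (G.bestConst 𝕜 p - bestConstLine 𝕜 p) :=
    (add_tsub_cancel_of_le hCD.le).symm
  have hlim := hu.tendsto_normSq
  rw [infQuotient_eq hp hP] at hlim
  set M := (G.bestConst 𝕜 p)⁻¹ + 1
  have hCi := ENNReal.inv_ne_top.2 hC0
  have hM : M ≠ ⊤ := ENNReal.add_ne_top.2 ⟨hCi, ENNReal.one_ne_top⟩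
  have hbd : ∀ᶠ n in atTop, (u n).normSq ≤ M :=
    (hlim.eventually (gt_mem_nhds (ENNReal.lt_add_right hCi one_ne_zero))).mono fun n hn => hn.le
  obtain ⟨φ₀, hφ₀, hrat₀⟩ := exists_subseq_cauchySeq_rat P hM hbd
  obtain ⟨k, hk⟩ := eventually_atTop.1 hbd
  -- The shift makes the energy bound hold for all terms instead of eventually.
  set φ : ℕ → ℕ := fun n => φ₀ (n + k)
  have hφ : StrictMono φ := fun a b hab => hφ₀ (by omega)
  have hφM : ∀ n, (u (φ n)).normSq ≤ M := fun n =>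
    hk _ ((Nat.le_add_left k n).trans (hφ₀.id_le _))
  have hw := hu.comp hφ.tendsto_atTop
  have hwlim := hlim.comp hφ.tendsto_atTop
  have huc : ∀ i, ∀ ε : ℝ≥0∞, ε ≠ 0 → ∃ n₀, ∀ n ≥ n₀, ∀ m ≥ n₀, ∀ x ∈ (P i).dom,
      ‖(P i).pull (u (φ n)).fn x - (P i).pull (u (φ m)).fn x‖ₑ ≤ ε := by
    intro i ε hε
    refine (P i).uniformCauchy (u := fun n => u (φ n)) hM hφM (fun q hq => ?_) ?_ hε
    · exact (hrat₀ i q hq).comp_tendsto (tendsto_add_atTop_nat k)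
    · intro ε hε
      rcases hray i with hR | ⟨ℓ, -, hdom⟩
      · obtain ⟨T, n₀, h⟩ := hR.tight hp hC hD hsplit hCt hδ hw.1 hwlim hε
        exact ⟨T, n₀, fun n hn x _ hx => h n hn x hx⟩
      -- On a bounded edge the tail condition is vacuous beyond its length.
      · refine ⟨ℓ + 1, 0, fun n _ x hx hx' => ?_⟩
        rw [hdom] at hx
        linarith [hx.2]
  have hcp := fun (ε : ℝ≥0∞) (hε : ε ≠ 0) =>
    cauchy_powInt hp hP (u := fun n => u (φ n)) hM hφM huc hε
  exact ⟨φ, hφ, H10.exists_limit (u := fun n => u (φ n)) fun ε hε =>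
    cauchy_distSq hp hCt hC0 hC hw.1 hwlim hcp hε⟩

/-- A sequence in the range is u ∘ k with k arbitrary. Either k increases strictly along a
subsequence, giving a subsequence of u, or it is nonincreasing along one, hence eventually constant.
-/
theorem isRelativelyCompact_range {u : ℕ → G.H10 𝕜}
    (h : ∀ ψ : ℕ → ℕ, StrictMono ψ → ∃ φ : ℕ → ℕ, StrictMono φ ∧ ∃ v : G.H10 𝕜,
      Tendsto (fun n => (u (ψ (φ n))).distSq v) atTop (𝓝 0)) :
    IsRelativelyCompact (Set.range u) := by
  intro s hs
  choose k hk using hs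
  obtain ⟨g, hg | hg⟩ := exists_increasing_or_nonincreasing_subseq (· < ·) k
  · obtain ⟨φ, hφ, v, hv⟩ := h (fun n => k (g n)) fun a b hab => hg a b hab
    exact ⟨fun n => g (φ n), g.strictMono.comp hφ, v, by simpa only [hk] using hv⟩
  · obtain ⟨n₀, hn₀⟩ := WellFoundedGT.monotone_chain_condition
      (⟨fun n => OrderDual.toDual (k (g n)), fun a b hab => by
        rcases hab.eq_or_lt with rfl | hab
        · exact le_rfl
        · exact not_lt.1 (hg a b hab)⟩ : ℕ →o ℕᵒᵈ)
    refine ⟨fun n => g (n₀ + n), fun a b hab => g.strictMono (by omega), s (g n₀), ?_⟩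
    have : ∀ n, (s (g (n₀ + n))).distSq (s (g n₀)) = 0 := by
      intro n
      have h1 : k (g n₀) = k (g (n₀ + n)) := hn₀ (n₀ + n) (Nat.le_add_right _ _)
      rw [← hk (g (n₀ + n)), ← hk (g n₀), h1]
      simp [H10.distSq, energy, energyOn]
    simp [this]

/-! ### Normalisation and existence of a minimiser. -/

theorem H10.powInt_comb_zero (hp : 2 < p) (c : 𝕜) (u : G.H10 𝕜) :
    (comb c 0 u u).powInt p = ‖c‖ₑ ^ p * u.powInt p := by
  unfold powInt powOn
  rw [← ENNReal.tsum_mul_left]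
  refine tsum_congr fun e => ?_
  rw [← lintegral_const_mul' _ _ (ENNReal.rpow_ne_top_of_nonneg (by linarith) (by simp))]
  refine lintegral_congr fun x => ?_
  simp only [comb, zero_mul, add_zero, enorm_mul]
  exact ENNReal.mul_rpow_of_nonneg _ _ (by linarith)

theorem H10.normSq_comb_zero (c : 𝕜) (u : G.H10 𝕜) :
    (comb c 0 u u).normSq = ‖c‖ₑ ^ 2 * u.normSq := by
  unfold normSq energy energyOn
  rw [← ENNReal.tsum_mul_left]
  refine tsum_congr fun e => ?_
  rw [← lintegral_const_mul' _ _ (by finiteness)]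
  refine lintegral_congr fun x => ?_
  simp only [comb, zero_mul, add_zero, enorm_mul]
  ring

theorem H10.exists_normalized (hp : 2 < p) {u : G.H10 𝕜} (h0 : u.powInt p ≠ 0)
    (ht : u.powInt p ≠ ⊤) : ∃ c : 𝕜, (comb c 0 u u).powInt p = 1 ∧
      (comb c 0 u u).quotient p = u.quotient p := by
  have hp0 : p ≠ 0 := by linarith
  set r : ℝ≥0∞ := u.powInt p ^ (-(1 / p))
  have hr : r ≠ ⊤ := ENNReal.rpow_ne_top_of_ne_zero h0 ht
  have hc : ‖((r.toReal : ℝ) : 𝕜)‖ₑ = r := by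
    rw [← ofReal_norm, RCLike.norm_ofReal, abs_of_nonneg ENNReal.toReal_nonneg,
      ENNReal.ofReal_toReal hr]
  have h1 : (comb ((r.toReal : ℝ) : 𝕜) 0 u u).powInt p = 1 := by
    rw [powInt_comb_zero hp, hc, ← ENNReal.rpow_mul, show -(1 / p) * p = -1 by field_simp,
      ENNReal.rpow_neg_one, ENNReal.inv_mul_cancel h0 ht]
  refine ⟨_, h1, ?_⟩
  rw [quotient_eq_normSq h1, normSq_comb_zero, hc, quotient, ← ENNReal.rpow_natCast,
    ← ENNReal.rpow_mul, ENNReal.div_eq_inv_mul, ← ENNReal.rpow_neg]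
  congr 2
  push_cast
  ring

theorem exists_isMinimizingSeq (hp : 2 < p) (hP : ∀ e, ∃ i, e ∈ (P i).carrier)
    (h0 : G.bestConst 𝕜 p ≠ 0) : ∃ u : ℕ → G.H10 𝕜, IsMinimizingSeq p u := by
  have hlt : G.infQuotient 𝕜 p < ⊤ := by
    rw [infQuotient_eq hp hP]
    exact (ENNReal.inv_ne_top.2 h0).lt_top
  obtain ⟨q, -, hq, hqlim⟩ := exists_seq_strictAnti_tendsto' hlt
  have hex : ∀ n, ∃ u : G.H10 𝕜, u.powInt p = 1 ∧ u.quotient p < q n := by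
    intro n
    have := (hq n).1
    simp only [infQuotient, iInf_lt_iff] at this
    obtain ⟨u, hu0, hu⟩ := this
    obtain ⟨c, hc1, hcq⟩ := H10.exists_normalized (𝕜 := 𝕜) hp hu0 (u.powInt_ne_top hp hP)
    exact ⟨_, hc1, hcq.trans_lt hu⟩
  choose u hu1 hu using hex
  refine ⟨u, hu1, tendsto_of_tendsto_of_tendsto_of_le_of_le tendsto_const_nhds hqlim
    (fun n => ?_) fun n => (hu n).le⟩
  exact iInf₂_le _ (by rw [hu1 n]; exact one_ne_zero)

/-- Convergence in H¹₀ implies convergence in L^p. For each weight θ < 1 the weighted inequalities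
pass to the limit and give θ^(p-1) ≤ ∫|v|^p and θ‖v‖² ≤ inf; then θ tends to 1. -/
theorem IsMinimizingSeq.isMinimizer_of_tendsto (hp : 2 < p) (hP : ∀ e, ∃ i, e ∈ (P i).carrier)
    {u : ℕ → G.H10 𝕜} (hu : IsMinimizingSeq p u) {v : G.H10 𝕜}
    (hv : Tendsto (fun n => (u n).distSq v) atTop (𝓝 0)) : IsMinimizer p v := by
  have hCt : G.bestConst 𝕜 p ≠ ⊤ := bestConst_ne_top hp hP
  have hlim := hu.tendsto_normSq
  have hpow : Tendsto (fun n => (H10.comb 1 (-1) (u n) v).powInt p) atTop (𝓝 0) := by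
    have h1 : Tendsto (fun n => (G.bestConst 𝕜 p * (u n).distSq v) ^ (p / 2)) atTop (𝓝 0) := by
      have h2 := (ENNReal.Tendsto.const_mul hv (.inr hCt)).ennrpow_const (p / 2)
      rwa [mul_zero, ENNReal.zero_rpow_of_pos (by linarith)] at h2
    refine tendsto_of_tendsto_of_tendsto_of_le_of_le tendsto_const_nhds h1 (fun _ => zero_le)
      fun n => ?_
    have h3 := ENNReal.rpow_le_rpow ((H10.comb 1 (-1) (u n) v).powInt_rpow_le hp hP)
      (show 0 ≤ p / 2 by linarith)
    rwa [← H10.distSq_eq_normSq, ← ENNReal.rpow_mul, show 2 / p * (p / 2) = 1 by field_simp,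
      ENNReal.rpow_one] at h3
  have hweights : ∀ θ : ℝ≥0∞, θ ≠ 0 → θ < 1 → θ ^ (p - 1) ≤ v.powInt p ∧
      θ * v.normSq ≤ G.infQuotient 𝕜 p := by
    intro θ hθ0 hθ1
    have hθt : θ ≠ ⊤ := (hθ1.trans ENNReal.one_lt_top).ne
    have hτ0 : 1 - θ ≠ 0 := (tsub_pos_of_lt hθ1).ne'
    have hτt : 1 - θ ≠ ⊤ := (tsub_le_self.trans_lt ENNReal.one_lt_top).ne
    have hsum : θ + (1 - θ) = 1 := add_tsub_cancel_of_le hθ1.le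
    constructor
    · have h1 : ∀ n, 1 ≤ θ ^ (1 - p) * v.powInt p +
          (1 - θ) ^ (1 - p) * (H10.comb 1 (-1) (u n) v).powInt p := fun n => by
        refine (hu.1 n).ge.trans (H10.powInt_le_weighted hp hsum hθ0 hτ0 fun e x => ?_)
        have e1 : (u n).fn e x = v.fn e x + (H10.comb 1 (-1) (u n) v).fn e x := by
          simp only [H10.comb]; ring
        conv_lhs => rw [e1]
        exact enorm_add_le _ _
      have h2 := (ENNReal.Tendsto.const_mul (a := (1 - θ) ^ (1 - p)) hpow
        (.inr (ENNReal.rpow_ne_top_of_ne_zero hτ0 hτt))).const_add (θ ^ (1 - p) * v.powInt p)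
      rw [mul_zero, add_zero] at h2
      have h3 := mul_le_mul_right (ge_of_tendsto' h2 h1) (θ ^ (p - 1))
      rw [← mul_assoc, ← ENNReal.rpow_add _ _ hθ0 hθt] at h3
      simpa using h3
    · have h1 : ∀ n, v.normSq ≤ θ⁻¹ * (u n).normSq + (1 - θ)⁻¹ * (u n).distSq v := fun n =>
        H10.normSq_le_weighted hsum hθ0 hτ0 v (u n)
      have h2 := (ENNReal.Tendsto.const_mul (a := θ⁻¹) hlim
        (.inr (ENNReal.inv_ne_top.2 hθ0))).add (ENNReal.Tendsto.const_mul (a := (1 - θ)⁻¹) hv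
        (.inr (ENNReal.inv_ne_top.2 hτ0)))
      rw [mul_zero, add_zero] at h2
      have h3 := mul_le_mul_right (ge_of_tendsto' h2 h1) θ
      rwa [← mul_assoc, ENNReal.mul_inv_cancel hθ0 hθt, one_mul] at h3
  have hpow1 : 1 ≤ v.powInt p := by
    refine le_of_forall_lt fun a ha => ?_
    obtain ⟨b, hab, hb⟩ := exists_between ha
    have hb0 : b ≠ 0 := (zero_le.trans_lt hab).ne'
    have hp1 : 0 < 1 / (p - 1) := by
      have : 0 < p - 1 := by linarith
      positivity
    have h1 := (hweights (b ^ (1 / (p - 1)))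
      (by simp [ENNReal.rpow_eq_zero_iff, hb0, (hb.trans ENNReal.one_lt_top).ne])
      (ENNReal.rpow_lt_one hb hp1)).1
    rw [← ENNReal.rpow_mul, one_div_mul_cancel (by linarith), ENNReal.rpow_one] at h1
    exact hab.trans_le h1
  have hE : v.normSq ≤ G.infQuotient 𝕜 p := by
    refine ENNReal.le_of_forall_lt_one_mul_le fun θ hθ => ?_
    by_cases hθ0 : θ = 0
    · simp [hθ0]
    · exact (hweights θ hθ0 hθ).2
  have hne : v.powInt p ≠ 0 := (zero_lt_one.trans_le hpow1).ne'
  refine ⟨hne, le_antisymm ?_ (iInf₂_le v hne)⟩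
  refine le_trans ?_ hE
  rw [H10.quotient]
  calc v.normSq / v.powInt p ^ (2 / p) ≤ v.normSq / 1 := by
        gcongr
        exact ENNReal.one_le_rpow hpow1 (by positivity)
    _ = v.normSq := div_one _

end MetricGraph

/-! ### Functions of the line moved out along a ray. -/

/-- The test function is the constant 1 on [0, 1], continued by ramps on both sides. -/
theorem bestConstLine_ne_zero (𝕜 : Type*) [RCLike 𝕜] {p : ℝ} (hp : 2 < p) :
    bestConstLine 𝕜 p ≠ 0 := by
  intro h0
  have h1 : IsH1On (Set.Icc (0 : ℝ) 1) (fun _ => (1 : 𝕜)) (fun _ => 0) :=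
    ⟨memLp_const _, memLp_const _, by simp⟩
  obtain ⟨F, D, hF, hF1, -⟩ := h1.exists_ramp_down zero_le_one
  obtain ⟨w, W, hw, hwF, -, -⟩ := hF.exists_ramp_up
  have h2 := powOn_rpow_le_bestConstLine (h0 ▸ ENNReal.zero_ne_top) hw
  rw [h0, zero_mul] at h2
  have hp0 : 0 < 2 / p := by positivity
  have h3 : powOn p Set.univ w = 0 := by
    by_contra hne
    rw [nonpos_iff_eq_zero, ENNReal.rpow_eq_zero_iff] at h2
    rcases h2 with h | h
    · exact hne h.1
    · linarith [h.2]
  have h4 : powOn p (Set.Icc 0 1) w = 1 := by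
    rw [powOn_congr (f₂ := fun _ => (1 : 𝕜)) measurableSet_Icc fun x hx => by
      rw [hwF x hx.1, hF1 x hx.2]]
    simp [powOn]
  have h5 := powOn_mono (Set.subset_univ (Set.Icc (0 : ℝ) 1)) p w
  rw [h3, h4] at h5
  exact absurd h5 (by simp)

theorem tendsto_powOn_Ici {𝕜 : Type*} [RCLike 𝕜] (p : ℝ) (f : ℝ → 𝕜) :
    Tendsto (fun k : ℕ => powOn p (Set.Ici (-(k : ℝ))) f) atTop (𝓝 (powOn p Set.univ f)) := by
  have hU : (⋃ k : ℕ, Set.Ici (-(k : ℝ))) = Set.univ := by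
    refine Set.eq_univ_of_forall fun x => Set.mem_iUnion.2 ?_
    obtain ⟨k, hk⟩ := exists_nat_ge (-x)
    exact ⟨k, by rw [Set.mem_Ici]; linarith⟩
  have hmono : Monotone fun k : ℕ => Set.Ici (-(k : ℝ)) := fun a b hab =>
    Set.Ici_subset_Ici.2 (neg_le_neg (Nat.cast_le.2 hab))
  have h := tendsto_measure_iUnion_atTop (μ := volume.withDensity fun x => ‖f x‖ₑ ^ p) hmono
  rw [hU, withDensity_apply _ MeasurableSet.univ] at h
  refine h.congr fun k => ?_
  exact withDensity_apply _ measurableSet_Ici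

/-- A function on the line can be replaced by one that vanishes far to the left, with almost the
same quotient. -/
theorem IsH1On.exists_vanishing_left {𝕜 : Type*} [RCLike 𝕜] {p : ℝ} (hp : 2 < p) {f g : ℝ → 𝕜}
    (h : IsH1On Set.univ f g) {C : ℝ≥0∞} (hC : C ≠ ⊤)
    (hlt : C * energyOn Set.univ f g < powOn p Set.univ f ^ (2 / p)) :
    ∃ (w W : ℝ → 𝕜) (t : ℝ), IsH1On Set.univ w W ∧ (∀ x ≤ t, w x = 0 ∧ W x = 0) ∧
      C * energyOn Set.univ w W < powOn p Set.univ w ^ (2 / p) := by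
  have hE := h.energyOn_lt_top.ne
  -- X splits the slack between two losses: the mass dropped to the left of -k₁, and the ramp at a
  -- point t of [-k₁ - k₂, -k₁] with |f t|² ≤ energy/k₂.
  obtain ⟨X, hX1, hX2⟩ := exists_between hlt
  have hev1 : ∀ᶠ k : ℕ in atTop, X < powOn p (Set.Ici (-(k : ℝ))) f ^ (2 / p) :=
    ((tendsto_powOn_Ici p f).ennrpow_const (2 / p)).eventually (lt_mem_nhds hX2)
  have hlim2 : Tendsto (fun k : ℕ => C * (energyOn Set.univ f g +
      2 * (energyOn Set.univ f g / ENNReal.ofReal (k : ℝ)))) atTop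
      (𝓝 (C * energyOn Set.univ f g)) := by
    have h1 : Tendsto (fun k : ℕ => energyOn Set.univ f g / ENNReal.ofReal (k : ℝ)) atTop
        (𝓝 0) := by
      simp only [ENNReal.ofReal_natCast]
      simpa using ENNReal.Tendsto.const_div ENNReal.tendsto_nat_nhds_top (.inr hE)
    have h2 := (ENNReal.Tendsto.const_mul (a := 2) h1 (.inr (by simp))).const_add
      (energyOn Set.univ f g)
    rw [mul_zero, add_zero] at h2
    exact ENNReal.Tendsto.const_mul h2 (.inr hC)
  obtain ⟨k₁, hk₁⟩ := hev1.exists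
  obtain ⟨k₂, hk₂, hk₂0⟩ := ((hlim2.eventually (gt_mem_nhds hX1)).and
    (eventually_gt_atTop 0)).exists
  have hk₂' : (0 : ℝ) < k₂ := Nat.cast_pos.2 hk₂0
  obtain ⟨t, ht, hft⟩ := h.exists_enorm_sq_le (a := -(k₁ : ℝ) - k₂) hk₂' (Set.subset_univ _)
  obtain ⟨w, W, hw, hwf, hw0, hwE⟩ := (h.mono (Set.subset_univ (Set.Ici t))).exists_ramp_up
  refine ⟨w, W, t - 1, hw, hw0, ?_⟩
  calc C * energyOn Set.univ w W
      ≤ C * (energyOn Set.univ f g + 2 * (energyOn Set.univ f g / ENNReal.ofReal (k₂ : ℝ))) := by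
        gcongr
        refine hwE.trans ?_
        gcongr
        exact energyOn_mono (Set.subset_univ _) _ _
    _ < X := hk₂
    _ < powOn p (Set.Ici (-(k₁ : ℝ))) f ^ (2 / p) := hk₁
    _ ≤ powOn p Set.univ w ^ (2 / p) := by
        gcongr
        calc powOn p (Set.Ici (-(k₁ : ℝ))) f ≤ powOn p (Set.Ici t) f :=
              powOn_mono (Set.Ici_subset_Ici.2 (by linarith [ht.2])) _ _
          _ = powOn p (Set.Ici t) w :=
              powOn_congr measurableSet_Ici fun x hx => (hwf x hx).symm
          _ ≤ _ := powOn_mono (Set.subset_univ _) _ _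

namespace MetricGraph

variable {V E : Type*} {G : MetricGraph V E} {𝕜 : Type*} [RCLike 𝕜] {p : ℝ}
  {ι : Type*} [Fintype ι] {P : ι → Part 𝕜 G}

/-- A function on the line can be moved far out on a ray of `G`. -/
theorem Part.IsRay.exists_far_copy {R : Part 𝕜 G} (hR : R.IsRay) (hp : 2 < p) {f g : ℝ → 𝕜}
    (h : IsH1On Set.univ f g) {C : ℝ≥0∞} (hC : C ≠ ⊤)
    (hlt : C * energyOn Set.univ f g < powOn p Set.univ f ^ (2 / p)) {T : ℝ} (hT : 0 ≤ T) :
    ∃ u : G.H10 𝕜, C * u.normSq < u.powInt p ^ (2 / p) ∧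
      (∀ e ∉ R.carrier, u.fn e = 0 ∧ u.der e = 0) ∧
      ∀ x ∈ Set.Icc 0 T, R.pull u.fn x = 0 ∧ R.pullDer u.der x = 0 := by
  obtain ⟨w, W, t, hw, hw0, hwlt⟩ := h.exists_vanishing_left hp hC hlt
  have hσ : (1 : ℝ) = 1 ∨ (1 : ℝ) = -1 := .inl rfl
  -- This translation carries t, to the left of which w vanishes, to the point T of the ray.
  have hφ := hw.comp_affine (t - T) hσ
  set φ : ℝ → 𝕜 := fun x => w (t - T + 1 * x)
  set ψ : ℝ → 𝕜 := fun x => ((1 : ℝ) : 𝕜) * W (t - T + 1 * x)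
  have h0 : ∀ x ≤ T, φ x = 0 ∧ ψ x = 0 := fun x hx => by
    have := hw0 (t - T + 1 * x) (by linarith)
    exact ⟨this.1, by simp only [ψ, this.2, mul_zero]⟩
  have hE : energyOn Set.univ φ ψ = energyOn Set.univ w W := by
    have := setLIntegral_comp_affine (t - T) hσ (fun x => ‖W x‖ₑ ^ 2 + ‖w x‖ₑ ^ 2) Set.univ
    rw [Set.preimage_univ] at this
    simpa [energyOn, φ, ψ] using this
  have hPow : powOn p Set.univ φ = powOn p Set.univ w := by
    have := setLIntegral_comp_affine (t - T) hσ (fun x => ‖w x‖ₑ ^ p) Set.univ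
    rw [Set.preimage_univ] at this
    exact this
  have hPow' : powOn p Set.univ φ = powOn p (Set.Ici 0) φ := by
    have h1 : ∫⁻ x in Set.Iic 0, ‖φ x‖ₑ ^ p = 0 := by
      rw [setLIntegral_congr_fun (g := fun _ => 0) measurableSet_Iic fun x hx => by
        simp only [(h0 x (le_trans hx hT)).1, enorm_zero,
          ENNReal.zero_rpow_of_pos (show 0 < p by linarith)]]
      simp
    unfold powOn
    rw [setLIntegral_split _ 0, Set.univ_inter, Set.univ_inter, h1, zero_add]
  rw [Set.preimage_univ] at hφ
  obtain ⟨u, hu, huR⟩ := hR.exists_extension (H10.zero G 𝕜) φ ψ (hφ.mono (Set.subset_univ _))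
    (by rw [(h0 0 hT).1]; rfl)
  have hu' : ∀ e ∉ R.carrier, u.fn e = 0 ∧ u.der e = 0 := hu
  refine ⟨u, ?_, hu', fun x hx => ?_⟩
  · have hEu : u.normSq ≤ energyOn Set.univ φ ψ := by
      rw [H10.normSq, R.energy_eq, hR.dom_eq, energyOn_congr measurableSet_Ici
        (fun x hx => (huR x hx).1) (.of_forall fun x hx => (huR x hx).2),
        ENNReal.tsum_eq_zero.2 fun e => by
          rw [(hu' e.1 e.2).1, (hu' e.1 e.2).2, energyOn_zero], add_zero]
      exact energyOn_mono (Set.subset_univ _) _ _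
    have hPu : powOn p Set.univ φ ≤ u.powInt p := by
      rw [R.powInt_eq, hR.dom_eq, hPow', powOn_congr measurableSet_Ici
        fun x hx => (huR x hx).1]
      exact le_self_add
    calc C * u.normSq ≤ C * energyOn Set.univ w W := by rw [← hE]; gcongr
      _ < powOn p Set.univ w ^ (2 / p) := hwlt
      _ ≤ _ := by rw [← hPow]; gcongr
  · rw [(huR x hx.1).1, (huR x hx.1).2]
    exact h0 x hx.2

/-- The only possible limit of a sequence of functions that move out along a ray is `0`. -/
theorem Part.IsRay.normSq_eq_zero_of_tendsto {R : Part 𝕜 G} (hR : R.IsRay) {u : ℕ → G.H10 𝕜}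
    (hoff : ∀ n, ∀ e ∉ R.carrier, (u n).fn e = 0 ∧ (u n).der e = 0)
    (hpull : ∀ n : ℕ, ∀ x ∈ Set.Icc (0 : ℝ) n,
      R.pull (u n).fn x = 0 ∧ R.pullDer (u n).der x = 0)
    {v : G.H10 𝕜} (hv : Tendsto (fun n => (u n).distSq v) atTop (𝓝 0)) : v.normSq = 0 := by
  -- Off the ray every term vanishes, and on [0, k] so do all terms with n ≥ k; the distance is then
  -- at least the energy of v on these pieces.
  have heq : ∀ n, (u n).distSq v =
      energyOn (Set.Ici 0) (R.pull ((u n).fn - v.fn)) (R.pullDer ((u n).der - v.der)) +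
      ∑' e : (R.carrierᶜ : Set E), energyOn (G.interval e) (v.fn e) (v.der e) := by
    intro n
    rw [H10.distSq, R.energy_eq, hR.dom_eq]
    congr 1
    refine tsum_congr fun e => ?_
    simp only [energyOn, Pi.sub_apply, (hoff n e.1 e.2).1, (hoff n e.1 e.2).2, Pi.zero_apply,
      zero_sub, enorm_neg]
  have h1 : ∑' e : (R.carrierᶜ : Set E), energyOn (G.interval e) (v.fn e) (v.der e) = 0 := by
    refine le_antisymm (ge_of_tendsto' hv fun n => ?_) zero_le
    rw [heq n]
    exact le_add_self
  have h2 : ∀ k : ℕ, energyOn (Set.Icc 0 (k : ℝ)) (R.pull v.fn) (R.pullDer v.der) = 0 := by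
    intro k
    refine le_antisymm (ge_of_tendsto hv ?_) zero_le
    filter_upwards [eventually_ge_atTop k] with n hn
    rw [heq n]
    refine le_trans ?_ le_self_add
    refine le_trans (le_of_eq ?_) (energyOn_mono (J := Set.Icc 0 (k : ℝ)) (fun x hx => hx.1) _ _)
    refine setLIntegral_congr_fun measurableSet_Icc fun x hx => ?_
    have h3 := hpull n x ⟨hx.1, hx.2.trans (Nat.cast_le.2 hn)⟩
    have e1 : R.pull ((u n).fn - v.fn) x = -R.pull v.fn x := by
      have : R.pull ((u n).fn - v.fn) x = R.pull (u n).fn x - R.pull v.fn x := rfl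
      rw [this, h3.1, zero_sub]
    have e2 : R.pullDer ((u n).der - v.der) x = -R.pullDer v.der x := by
      have : R.pullDer ((u n).der - v.der) x = R.pullDer (u n).der x - R.pullDer v.der x :=
        mul_sub _ _ _
      rw [this, h3.2, zero_sub]
    simp only [e1, e2, enorm_neg]
  rw [H10.normSq, R.energy_eq, h1, add_zero, hR.dom_eq]
  have hU : Set.Ici (0 : ℝ) = ⋃ k : ℕ, Set.Icc 0 (k : ℝ) := by
    ext x
    simp only [Set.mem_Ici, Set.mem_iUnion, Set.mem_Icc]
    exact ⟨fun hx => (exists_nat_ge x).imp fun k hk => ⟨hx, hk⟩, fun ⟨_, h⟩ => h.1⟩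
  rw [hU]
  refine le_antisymm ((lintegral_iUnion_le _ _).trans (le_of_eq ?_)) zero_le
  exact ENNReal.tsum_eq_zero.2 h2

/-- If the best constant of `G` does not exceed that of the line, then some minimising sequence
moves out along a ray. -/
theorem Part.IsRay.exists_escaping_isMinimizingSeq {R : Part 𝕜 G} (hR : R.IsRay) (hp : 2 < p)
    (hP : ∀ e, ∃ i, e ∈ (P i).carrier) (hCD : G.bestConst 𝕜 p ≤ bestConstLine 𝕜 p) :
    ∃ u : ℕ → G.H10 𝕜, IsMinimizingSeq p u ∧
      (∀ n, ∀ e ∉ R.carrier, (u n).fn e = 0 ∧ (u n).der e = 0) ∧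
      ∀ n : ℕ, ∀ x ∈ Set.Icc (0 : ℝ) n, R.pull (u n).fn x = 0 ∧ R.pullDer (u n).der x = 0 := by
  obtain ⟨D, -, hD, hDlim⟩ := exists_seq_strictMono_tendsto'
    (pos_iff_ne_zero.2 (bestConstLine_ne_zero 𝕜 hp))
  have hex : ∀ n : ℕ, ∃ u : G.H10 𝕜, u.powInt p = 1 ∧ u.quotient p ≤ (D n)⁻¹ ∧
      (∀ e ∉ R.carrier, u.fn e = 0 ∧ u.der e = 0) ∧
      ∀ x ∈ Set.Icc (0 : ℝ) n, R.pull u.fn x = 0 ∧ R.pullDer u.der x = 0 := by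
    intro n
    have hnot := notMem_of_lt_csInf (hD n).2 (OrderBot.bddBelow _)
    simp only [Set.mem_ofPred_eq, not_forall, not_le] at hnot
    obtain ⟨f, g, hfg, hlt⟩ := hnot
    obtain ⟨u, hu, huoff, hupull⟩ := hR.exists_far_copy hp hfg (hD n).2.ne_top hlt n.cast_nonneg
    obtain ⟨hu0, hu1⟩ := mul_quotient_le_one hp hu
    obtain ⟨c, hc1, hcq⟩ := H10.exists_normalized (𝕜 := 𝕜) hp hu0 (u.powInt_ne_top hp hP)
    refine ⟨_, hc1, ?_, fun e he => ?_, fun x hx => ?_⟩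
    · rw [hcq, ENNReal.le_inv_iff_mul_le, mul_comm]
      exact hu1
    · constructor <;> funext x <;> simp [H10.comb, huoff e he]
    · have h1 := hupull x hx
      simp only [Part.pull, Part.pullDer, H10.comb, zero_mul, add_zero] at h1 ⊢
      rw [h1.1, mul_left_comm, h1.2]
      simp
  choose u hu1 huq huoff hupull using hex
  have hinf : ∀ n, G.infQuotient 𝕜 p ≤ (u n).quotient p := fun n =>
    iInf₂_le _ (by rw [hu1 n]; exact one_ne_zero)
  have hlim : Tendsto (fun n => (D n)⁻¹) atTop (𝓝 (bestConstLine 𝕜 p)⁻¹) :=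
    tendsto_inv_iff.2 hDlim
  -- The translated functions give inf ≤ 1/C_p(ℝ), and C_p(G) ≤ C_p(ℝ) gives the reverse: the two
  -- constants coincide in this case.
  have heq : (bestConstLine 𝕜 p)⁻¹ = G.infQuotient 𝕜 p := by
    refine le_antisymm ?_ (ge_of_tendsto' hlim fun n => (hinf n).trans (huq n))
    rw [infQuotient_eq hp hP]
    exact ENNReal.inv_le_inv.2 hCD
  rw [heq] at hlim
  exact ⟨u, ⟨hu1, tendsto_of_tendsto_of_tendsto_of_le_of_le tendsto_const_nhds hlim hinf huq⟩,
    huoff, hupull⟩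

end MetricGraph

/-! ### The main theorem. -/

theorem mainTheorem3 {𝕜 : Type*} [RCLike 𝕜] {V E : Type*} (G : MetricGraph V E)
    (p : ℝ) (hp : 2 < p) (hfin : G.LocallyFinite) (hunb : G.IsUnbounded)
    (hhalf : G.UnboundedOnlyAlongHalfLines) :
    ((∀ u : ℕ → G.H10 𝕜, MetricGraph.IsMinimizingSeq p u →
        MetricGraph.IsRelativelyCompact (Set.range u)) ↔
      bestConstLine 𝕜 p < G.bestConst 𝕜 p) ∧
    (bestConstLine 𝕜 p < G.bestConst 𝕜 p →
      ∃ v : G.H10 𝕜, MetricGraph.IsMinimizer p v) := by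
  obtain ⟨ι, _, P, hP, hray⟩ := hhalf.exists_cover 𝕜
  refine ⟨⟨fun hcomp => ?_, fun hCD u hu => ?_⟩, fun hCD => ?_⟩
  · by_contra hCD
    rw [not_lt] at hCD
    obtain ⟨R, hR⟩ := hhalf.exists_isRay hunb 𝕜
    obtain ⟨u, hu, hoff, hpull⟩ := hR.exists_escaping_isMinimizingSeq hp hP hCD
    obtain ⟨φ, hφ, v, hv⟩ := hcomp u hu u fun n => ⟨n, rfl⟩
    have hv0 : v.normSq = 0 := hR.normSq_eq_zero_of_tendsto (u := fun n => u (φ n))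
      (fun n => hoff (φ n))
      -- Since n ≤ φ n, the subsequence still vanishes on [0, n].
      (fun n x hx => hpull (φ n) x ⟨hx.1, hx.2.trans (Nat.cast_le.2 (hφ.id_le n))⟩) hv
    have hlim := (hu.comp hφ.tendsto_atTop).tendsto_normSq
    have hlim0 : Tendsto (fun n => (u (φ n)).normSq) atTop (𝓝 0) := by
      -- Equal weights 1/2 and v = 0 in norm give ‖u‖² ≤ 2 · distance², so the energies would tend
      -- to 0.
      have h2 := ENNReal.Tendsto.const_mul (a := (2⁻¹)⁻¹) hv (.inr (by simp))
      rw [mul_zero] at h2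
      refine tendsto_of_tendsto_of_tendsto_of_le_of_le tendsto_const_nhds h2
        (fun _ => zero_le) fun n => ?_
      have h3 := MetricGraph.H10.normSq_le_weighted ENNReal.inv_two_add_inv_two (by simp)
        (by simp) (u (φ n)) v
      rwa [hv0, mul_zero, zero_add, MetricGraph.H10.distSq_comm] at h3
    have h0 := tendsto_nhds_unique hlim hlim0
    rw [MetricGraph.infQuotient_eq hp hP, ENNReal.inv_eq_zero] at h0
    exact MetricGraph.bestConst_ne_top hp hP h0
  · exact MetricGraph.isRelativelyCompact_range fun ψ hψ =>
      (hu.comp hψ.tendsto_atTop).exists_subseq hp hP hray hCD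
  · have h0 : G.bestConst 𝕜 p ≠ 0 := (zero_le.trans_lt hCD).ne'
    obtain ⟨u, hu⟩ := MetricGraph.exists_isMinimizingSeq hp hP h0
    obtain ⟨φ, hφ, v, hv⟩ := hu.exists_subseq hp hP hray hCD
    exact ⟨v, (hu.comp hφ.tendsto_atTop).isMinimizer_of_tendsto hp hP hv⟩
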